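/- **Theorem 4.2.** Graphs are finite and simple. Write $|G|$ and $\|G\|$ for the numbers of vertices and edges of $G$, $\delta(G)$ and $\Delta(G)$ for its minimum and maximum degree, $\xi(G)=\min\{\deg x+\deg y-2 : xy\in E(G)\}$ for its minimum edge-degree, and $ad(G)=2\|G\|/|G|$ for its average degree. For a graph without isolated vertices, $\gamma_{tr}(G)$ is the least size of a set $S\subseteq V(G)$ such that every vertex has a neighbour in $S$ and every vertex outside $S$ has a neighbour outside $S$. The total restrained bondage number $b_{tr}(G)$ is the least size of a set $E_1\subseteq E(G)$ such that $G-E_1$ has no isolated vertex and $\gamma_{tr}(G-E_1)>\gamma_{tr}(G)$ (and $b_{tr}(G)=\infty$ if there is no such set). Surfaces are closed and connected: $\mathbb S_h$ is the sphere with $h\ge 0$ handles, of Euler characteristic $2-2h$, and $\mathbb N_q$ is the sphere with $q\ge1$ crosscaps, of Euler characteristic $2-q$. The orientable (nonorientable) genus of $G$ is the least $h\ge 0$ (the least $q\ge 1$) such that $G$ embeds on $\mathbb S_h$ (on $\mathbb N_q$). Put $$h_1(x)=\begin{cases}2x+13& 0\le x\le 3\\ 4x+7& x\ge 3,\end{cases}\qquad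 h_2(x)=\begin{cases}8& x=0\\ 4x+5& x\ge 1,\end{cases}$$ $$k_1(x)=\begin{cases}2x+11& 1\le x\le 2\\ 2x+9& 3\le x\le 5\\ 2x+7& x\ge 6,\end{cases}\qquad k_2(x)=\begin{cases}8& x=1\\ 2x+5& x\ge 2.\end{cases}$$ Let $G$ be a connected graph with $\delta(G)\ge 4$. Then $b_{tr}(G)$ is finite, and: (i) $b_{tr}(G)\le \xi(G)+\Delta(G)-2$. (ii) If $G$ has orientable genus $g$, then $b_{tr}(G)\le h_1(g)+\Delta(G)-4$; if moreover $G$ has no $3$-cycles, then $b_{tr}(G)\le h_2(g)+\Delta(G)-4$. (iii) If $G$ has nonorientable genus $\overline g$, then $b_{tr}(G)\le k_1(\overline g)+\Delta(G)-4$; if moreover $G$ has no $3$-cycles, then $b_{tr}(G)\le k_2(\overline g)+\Delta(G)-4$. (iv) $b_{tr}(G)\le 2\,ad(G)+\Delta(G)-4$. (v) If $\chi$ is the largest Euler characteristic of a surface on which $G$ embeds and $g$ is the girth of $G$, then $$b_{tr}(G)\le \frac{4g}{g-2}\Bigl(1-\frac{\chi}{|G|}\Bigr)+\Delta(G)-4\le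 -\frac{12\chi}{|G|}+\Delta(G)+8.$$ -/

import Mathlib

noncomputable section

namespace SurfaceBondage

/-! ### Total restrained domination and bondage -/

section Bondage

variable {V : Type*}

/-- The graph has no isolated vertex. -/
def IsolateFree (G : SimpleGraph V) : Prop := ∀ v, ∃ w, G.Adj v w

/-- `S` is a total restrained dominating set: every vertex has a neighbour in `S`, and every
vertex outside `S` has a neighbour outside `S`. -/
def IsTotalRestrainedDominating (G : SimpleGraph V) (S : Finset V) : Prop :=
  (∀ v, ∃ w ∈ S, G.Adj v w) ∧ (∀ v, v ∉ S → ∃ w, w ∉ S ∧ G.Adj v w)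

/-- The total restrained domination number (`⊤` if there is no total restrained dominating set;
in an isolate-free finite graph the whole vertex set is one). -/
def totalRestrainedDominationNumber (G : SimpleGraph V) : ℕ∞ :=
  ⨅ (S : Finset V) (_ : IsTotalRestrainedDominating G S), (S.card : ℕ∞)

/-- The removal of the edges in `E₁` leaves no isolated vertex and increases the total restrained
domination number. -/
def IsTotalRestrainedBondageSet (G : SimpleGraph V) (E₁ : Finset (Sym2 V)) : Prop :=
  (E₁ : Set (Sym2 V)) ⊆ G.edgeSet ∧
    IsolateFree (G.deleteEdges (E₁ : Set (Sym2 V))) ∧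
    totalRestrainedDominationNumber G <
      totalRestrainedDominationNumber (G.deleteEdges (E₁ : Set (Sym2 V)))

/-- The total restrained bondage number, `⊤` if no set of edges qualifies. -/
def totalRestrainedBondageNumber (G : SimpleGraph V) : ℕ∞ :=
  ⨅ (E₁ : Finset (Sym2 V)) (_ : IsTotalRestrainedBondageSet G E₁), (E₁.card : ℕ∞)

/-- The minimum edge-degree: the least value of `deg x + deg y - 2` over all edges `xy`. -/
def minEdgeDegree [Fintype V] (G : SimpleGraph V) [DecidableRel G.Adj] : ℕ :=
  sInf {k | ∃ x y, G.Adj x y ∧ k = G.degree x + G.degree y - 2}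

/-- The average degree `2‖G‖ / |G|`. -/
def averageDegree [Fintype V] (G : SimpleGraph V) [DecidableRel G.Adj] : ℝ :=
  2 * (G.edgeFinset.card : ℝ) / (Fintype.card V : ℝ)

end Bondage

/-! ### Closed surfaces and embeddings -/

/-- The homeomorphism types of closed connected surfaces: the sphere with `h` handles, and the
sphere with `q ≥ 1` crosscaps. -/
inductive ClosedSurface : Type
  | orientable (h : ℕ) : ClosedSurface
  | nonorientable (q : ℕ) (hq : 1 ≤ q) : ClosedSurface

/-- The Euler characteristic: `2 - 2h` with `h` handles, `2 - q` with `q` crosscaps. -/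
def ClosedSurface.eulerChar : ClosedSurface → ℤ
  | .orientable h => 2 - 2 * (h : ℤ)
  | .nonorientable q _ => 2 - (q : ℤ)

/-- A finite polygonal decomposition of a closed connected surface, given by its flags. A flag is
a triple (corner, side at that corner, polygon); equivalently, a triangle of the barycentric
subdivision. The fixed-point free involutions `r₀`, `r₁`, `r₂` exchange a flag with the flag that
differs from it exactly in the vertex, in the edge, in the polygon. Every edge carries exactly
four flags, which is what the conditions on `r₀ * r₂` express. Vertices may be joined by several
edges, and loops are allowed. -/
structure PolygonalSurface (F : Type) where
  r₀ : Equiv.Perm F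
  r₁ : Equiv.Perm F
  r₂ : Equiv.Perm F
  invol₀ : ∀ x, r₀ (r₀ x) = x
  invol₁ : ∀ x, r₁ (r₁ x) = x
  invol₂ : ∀ x, r₂ (r₂ x) = x
  ne₀ : ∀ x, r₀ x ≠ x
  ne₁ : ∀ x, r₁ x ≠ x
  ne₂ : ∀ x, r₂ x ≠ x
  comm : ∀ x, r₀ (r₂ x) = r₂ (r₀ x)
  ne₀₂ : ∀ x, r₀ (r₂ x) ≠ x
  nonempty : Nonempty F
  connected : ∀ x y, Relation.EqvGen (fun a b => b = r₀ a ∨ b = r₁ a ∨ b = r₂ a) x y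

namespace PolygonalSurface

variable {F : Type} (M : PolygonalSurface F)

/-- Vertices: orbits of flags under `r₁` and `r₂`. -/
def Vertex : Type := Quot (fun a b : F => b = M.r₁ a ∨ b = M.r₂ a)

/-- Edges: orbits of flags under `r₀` and `r₂`. -/
def Edge : Type := Quot (fun a b : F => b = M.r₀ a ∨ b = M.r₂ a)

/-- Faces: orbits of flags under `r₀` and `r₁`. -/
def Face : Type := Quot (fun a b : F => b = M.r₀ a ∨ b = M.r₁ a)

/-- The vertex of a flag. -/
def vertexOf (x : F) : M.Vertex := Quot.mk _ x

/-- The Euler characteristic of the surface: vertices minus edges plus faces. -/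
def eulerChar : ℤ :=
  (Nat.card M.Vertex : ℤ) - (Nat.card M.Edge : ℤ) + (Nat.card M.Face : ℤ)

/-- The triangles of the barycentric subdivision can be oriented coherently, i.e. coloured with
two colours so that triangles with a common side have different colours. -/
def IsOrientable : Prop :=
  ∃ c : F → Bool, ∀ x, c (M.r₀ x) ≠ c x ∧ c (M.r₁ x) ≠ c x ∧ c (M.r₂ x) ≠ c x

/-- The decomposed surface is of the given homeomorphism type; closed connected surfaces are
classified by orientability and Euler characteristic. -/
def IsOfType (S : ClosedSurface) : Prop :=
  (match S with
    | .orientable _ => M.IsOrientable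
    | .nonorientable _ _ => ¬ M.IsOrientable) ∧ M.eulerChar = S.eulerChar

/-- `G` is drawn without crossings in the 1-skeleton of the decomposition: distinct vertices go to
distinct vertices, and every edge of `G` to an edge with the corresponding ends. As `G` is simple,
different edges of `G` then go to different edges. Vertices and edges of the decomposition that do
not come from `G` are allowed, so the faces of the drawing of `G` itself need not be discs. -/
def Carries {V : Type*} (G : SimpleGraph V) : Prop :=
  ∃ f : V → M.Vertex, Function.Injective f ∧
    ∀ v w, G.Adj v w → ∃ x : F, M.vertexOf x = f v ∧ M.vertexOf (M.r₀ x) = f w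

end PolygonalSurface

/-- `G` embeds on the closed surface `S`: some finite polygonal decomposition of `S` contains `G`
in its 1-skeleton. The embedding is not required to be 2-cell. -/
def EmbedsOn {V : Type*} (G : SimpleGraph V) (S : ClosedSurface) : Prop :=
  ∃ (F : Type) (_ : Finite F) (M : PolygonalSurface F), M.IsOfType S ∧ M.Carries G

/-- `g` is the orientable genus of `G`. -/
def IsOrientableGenus {V : Type*} (G : SimpleGraph V) (g : ℕ) : Prop :=
  IsLeast {h : ℕ | EmbedsOn G (.orientable h)} g

/-- `q` is the nonorientable genus of `G`: the least number `q ≥ 1` of crosscaps. -/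
def IsNonorientableGenus {V : Type*} (G : SimpleGraph V) (q : ℕ) : Prop :=
  IsLeast {k : ℕ | ∃ hk : 1 ≤ k, EmbedsOn G (.nonorientable k hk)} q

/-- `χ` is the largest Euler characteristic of a surface on which `G` embeds. -/
def IsMaxEulerChar {V : Type*} (G : SimpleGraph V) (χ : ℤ) : Prop :=
  IsGreatest {c : ℤ | ∃ S : ClosedSurface, EmbedsOn G S ∧ c = S.eulerChar} χ

/-! ### The bounding functions -/

def h₁ (x : ℕ) : ℕ := if x ≤ 3 then 2 * x + 13 else 4 * x + 7

def h₂ (x : ℕ) : ℕ := if x = 0 then 8 else 4 * x + 5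

/-- Used for `x ≥ 1` only. -/
def k₁ (x : ℕ) : ℕ := if x ≤ 2 then 2 * x + 11 else if x ≤ 5 then 2 * x + 9 else 2 * x + 7

/-- Used for `x ≥ 1` only. -/
def k₂ (x : ℕ) : ℕ := if x ≤ 1 then 8 else 2 * x + 5

end SurfaceBondage

end

namespace SurfaceBondage

open SimpleGraph

/-! ### Bondage sets from pairs of vertices at distance at most two. -/

section Bondage

variable {V : Type*}

/-! Turning vertices into leaves forces them and their neighbours into every total restrained
dominating set. If `xy` becomes a component and a neighbour `z` of `x` a leaf, or if a path `xwy`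
becomes a component, the forced set is wasteful: in `G` one or more of the vertices of the edge or
path can be dropped from it. Hence (`bondage_adj`, `bondage_common_neighbor`) b + 4 ≤ deg x + deg y
+ Δ for any distinct x, y at distance at most two, and it remains to find such a pair with small
degree sum.

An edge attaining ξ gives (i); averaging gives (iv), and Euler's inequality with the girth turns
(iv) into (v). For (ii) and (iii), suppose that every edge has degree sum at least D. Discharging
bounds |E| from above in terms of -χ and D (`eulerChar_mul_le`), while a vertex of minimum degree
and its neighbours force many edges (`exists_le_two_mul_card_edges`); for the stated D the two are
incompatible.

The only topology needed is χ + |E| ≤ |V| + #regions, and a cycle of `G` along each region. Both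
come from linear algebra over 𝔽₂ (`eulerChar_add_card_le`, `RegionSystem`), so regions need not be
discs. -/

theorem totalRestrainedBondageNumber_le {G : SimpleGraph V} {E : Finset (Sym2 V)}
    (h : IsTotalRestrainedBondageSet G E) : totalRestrainedBondageNumber G ≤ E.card :=
  iInf₂_le E h

theorem IsTotalRestrainedDominating.univ [Fintype V] {G : SimpleGraph V} (h : IsolateFree G) :
    IsTotalRestrainedDominating G Finset.univ :=
  ⟨fun v => (h v).imp fun w hw => ⟨Finset.mem_univ w, hw⟩,
      fun v hv => absurd (Finset.mem_univ v) hv⟩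

/-- If every total restrained dominating set of `H` can be turned into a smaller one of `G`,
then the domination number of `H` exceeds that of `G`. -/
theorem totalRestrainedDominationNumber_lt [Fintype V] {G H : SimpleGraph V} (hG : IsolateFree G)
    (h : ∀ S, IsTotalRestrainedDominating H S →
      ∃ T, IsTotalRestrainedDominating G T ∧ T.card < S.card) :
    totalRestrainedDominationNumber G < totalRestrainedDominationNumber H := by
  have hfin : totalRestrainedDominationNumber G ≠ ⊤ := by
    refine ne_top_of_le_ne_top (ENat.natCast_ne_top (Finset.univ : Finset V).card) ?_
    exact iInf₂_le _ (IsTotalRestrainedDominating.univ hG)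
  rw [← ENat.add_one_le_iff hfin]
  refine le_iInf₂ fun S hS => ?_
  obtain ⟨T, hT, hlt⟩ := h S hS
  calc totalRestrainedDominationNumber G + 1 ≤ (T.card : ℕ∞) + 1 := by
        gcongr; exact iInf₂_le T hT
    _ ≤ S.card := by exact_mod_cast hlt

theorem isTotalRestrainedBondageSet_of_reduction [Fintype V] {G : SimpleGraph V}
    {E : Finset (Sym2 V)} (hE : (E : Set (Sym2 V)) ⊆ G.edgeSet)
    (hiso : IsolateFree (G.deleteEdges (E : Set (Sym2 V))))
    (h : ∀ S, IsTotalRestrainedDominating (G.deleteEdges (E : Set (Sym2 V))) S →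
      ∃ T, IsTotalRestrainedDominating G T ∧ T.card < S.card) :
    IsTotalRestrainedBondageSet G E :=
  ⟨hE, hiso, totalRestrainedDominationNumber_lt
    (fun v => (hiso v).imp fun _ hw => deleteEdges_le _ hw) h⟩

/-- A leaf and its neighbour belong to every total restrained dominating set. -/
theorem IsTotalRestrainedDominating.mem_of_leaf {G : SimpleGraph V} {S : Finset V}
    (hS : IsTotalRestrainedDominating G S) {x y : V} (h : ∀ w, G.Adj x w → w = y) :
    x ∈ S ∧ y ∈ S := by
  have hy : y ∈ S := by
    obtain ⟨w, hw, hxw⟩ := hS.1 x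
    exact h w hxw ▸ hw
  refine ⟨?_, hy⟩
  by_contra hx
  obtain ⟨w, hw, hxw⟩ := hS.2 x hx
  exact hw (h w hxw ▸ hy)

variable [Fintype V] {G : SimpleGraph V} [DecidableRel G.Adj]

theorem exists_adj_notMem_of_card_lt_degree {v : V} {A : Finset V}
    (h : A.card < G.degree v) : ∃ w, G.Adj v w ∧ w ∉ A := by
  classical
  obtain ⟨w, hw, hA⟩ := Finset.exists_mem_notMem_of_card_lt_card (h.trans_eq
      (G.card_neighborFinset_eq_degree v).symm)
  exact ⟨w, by simpa using hw, hA⟩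

/-- In `H` the edge `xy` is a component and `z`, a `G`-neighbour of `x`, is a leaf. -/
theorem IsTotalRestrainedDominating.reduce_isolated_edge {H : SimpleGraph V} (hle : H ≤ G)
    {x y z t : V} (hxy : G.Adj x y) (hxz : G.Adj x z) (hzy : z ≠ y) (hdy : 2 ≤ G.degree y)
    (hx : ∀ w, H.Adj x w → w = y) (hy : ∀ w, H.Adj y w → w = x) (hz : ∀ w, H.Adj z w → w = t)
    {S : Finset V} (hS : IsTotalRestrainedDominating H S) :
    ∃ T, IsTotalRestrainedDominating G T ∧ T.card < S.card := by
  classical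
  obtain ⟨hxS, hyS⟩ := hS.mem_of_leaf hx
  have hzS := (hS.mem_of_leaf hz).1
  have hzx : z ≠ x := hxz.ne'
  by_cases h : ∃ s ∈ S, s ≠ x ∧ G.Adj y s
  -- Both ends can go: `z` dominates `x`, `s` dominates `y`, and `x`, `y` serve each other as
  -- neighbours outside the set.
  · obtain ⟨s, hsS, hsx, hys⟩ := h
    refine ⟨(S.erase x).erase y, ⟨fun v => ?_, fun v hv => ?_⟩, ?_⟩
    · by_cases hvx : v = x
      · exact ⟨z, by simp [*], hvx ▸ hxz⟩
      by_cases hvy : v = y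
      · exact ⟨s, by simp [*, hys.ne'], hvy ▸ hys⟩
      obtain ⟨w, hw, hvw⟩ := hS.1 v
      refine ⟨w, ?_, hle hvw⟩
      simp only [Finset.mem_erase]
      refine ⟨?_, ?_, hw⟩
      · rintro rfl; exact hvx (hy v hvw.symm)
      · rintro rfl; exact hvy (hx v hvw.symm)
    · by_cases hvx : v = x
      · exact ⟨y, by simp, hvx ▸ hxy⟩
      by_cases hvy : v = y
      · exact ⟨x, by simp, hvy ▸ hxy.symm⟩
      obtain ⟨w, hw, hvw⟩ := hS.2 v (by simpa [hvx, hvy] using hv)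
      exact ⟨w, by simp [hw], hle hvw⟩
    · exact (Finset.card_le_card (Finset.erase_subset_erase _ (Finset.erase_subset _ _))).trans_lt
        (Finset.card_erase_lt_of_mem hyS)
  -- All `G`-neighbours of `y` except `x` avoid `S`, so `y` alone is dropped and any of them is its
  -- neighbour outside.
  · push Not at h
    refine ⟨S.erase y, ⟨fun v => ?_, fun v hv => ?_⟩, Finset.card_erase_lt_of_mem hyS⟩
    · by_cases hvx : v = x
      · exact ⟨z, by simp [*], hvx ▸ hxz⟩
      by_cases hvy : v = y
      · exact ⟨x, by simp [hxS, hxy.ne], hvy ▸ hxy.symm⟩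
      obtain ⟨w, hw, hvw⟩ := hS.1 v
      refine ⟨w, ?_, hle hvw⟩
      simp only [Finset.mem_erase]
      refine ⟨?_, hw⟩
      rintro rfl; exact hvx (hy v hvw.symm)
    · by_cases hvy : v = y
      · obtain ⟨w, hyw, hwx⟩ := exists_adj_notMem_of_card_lt_degree (G := G) (v := y) (A := {x})
          (by simpa using Nat.lt_of_succ_le hdy)
        refine ⟨w, fun hw => h w (Finset.mem_of_mem_erase hw) (by simpa using hwx) hyw, hvy ▸ hyw⟩
      obtain ⟨w, hw, hvw⟩ := hS.2 v (by simpa [hvy] using hv)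
      exact ⟨w, by simp [hw], hle hvw⟩

/-- In `H` the path `xwy` is a component. -/
theorem IsTotalRestrainedDominating.reduce_isolated_path {H : SimpleGraph V} (hle : H ≤ G)
    {x y w : V} (hxw : G.Adj x w) (hyw : G.Adj y w) (hne : x ≠ y) (hdx : 3 ≤ G.degree x)
    (hdy : 3 ≤ G.degree y) (hdw : 3 ≤ G.degree w)
    (hx : ∀ v, H.Adj x v → v = w) (hy : ∀ v, H.Adj y v → v = w)
    (hw : ∀ v, H.Adj w v → v = x ∨ v = y)
    {S : Finset V} (hS : IsTotalRestrainedDominating H S) :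
    ∃ T, IsTotalRestrainedDominating G T ∧ T.card < S.card := by
  classical
  obtain ⟨hxS, hwS⟩ := hS.mem_of_leaf hx
  have hyS := (hS.mem_of_leaf hy).1
  have hdom : ∀ v, v ≠ x → v ≠ y → v ≠ w →
      ∃ u ∈ S, u ≠ x ∧ u ≠ y ∧ u ≠ w ∧ G.Adj v u := by
    intro v hvx hvy hvw
    obtain ⟨u, hu, hvu⟩ := hS.1 v
    refine ⟨u, hu, ?_, ?_, ?_, hle hvu⟩
    · rintro rfl; exact hvw (hx v hvu.symm)
    · rintro rfl; exact hvw (hy v hvu.symm)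
    · rintro rfl; exact (hw v hvu.symm).elim hvx hvy
  have hkeep : ∀ v, v ∉ S → ∃ u, u ∉ S ∧ G.Adj v u := fun v hv =>
    (hS.2 v hv).imp fun u hu => ⟨hu.1, hle hu.2⟩
  -- the removal of a single vertex of the path
  have single : ∀ a ∈ S, (a = x ∨ a = y ∨ a = w) → 3 ≤ G.degree a →
      (∀ u ∈ S, u ≠ x → u ≠ y → u ≠ w → ¬ G.Adj a u) →
      (∀ v, v = x ∨ v = y ∨ v = w → ∃ u ∈ S, u ≠ a ∧ G.Adj v u) →
      ∃ T, IsTotalRestrainedDominating G T ∧ T.card < S.card := by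
    intro a ha hpath hda hout hin
    refine ⟨S.erase a, ⟨fun v => ?_, fun v hv => ?_⟩, Finset.card_erase_lt_of_mem ha⟩
    · by_cases hv : v = x ∨ v = y ∨ v = w
      · obtain ⟨u, hu, hua, hvu⟩ := hin v hv
        exact ⟨u, Finset.mem_erase.2 ⟨hua, hu⟩, hvu⟩
      · push Not at hv
        obtain ⟨u, hu, h1, h2, h3, hvu⟩ := hdom v hv.1 hv.2.1 hv.2.2
        refine ⟨u, Finset.mem_erase.2 ⟨?_, hu⟩, hvu⟩
        rintro rfl
        tauto
    · by_cases hva : v = a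
      · subst hva
        obtain ⟨u, hu, hun⟩ := exists_adj_notMem_of_card_lt_degree (G := G) (v := v)
          (A := ({x, y, w} : Finset V).erase v) (by
            have h1 := Finset.card_erase_of_mem (s := ({x, y, w} : Finset V)) (a := v) (by simpa)
            have h2 := Finset.card_le_three (a := x) (b := y) (c := w)
            omega)
        refine ⟨u, fun huS => ?_, hu⟩
        simp only [Finset.mem_erase, Finset.mem_insert, Finset.mem_singleton, not_and,
            not_or] at hun
        obtain ⟨h1, h2, h3⟩ := hun hu.ne'
        exact hout u (Finset.mem_of_mem_erase huS) h1 h2 h3 hu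
      · obtain ⟨u, hu, hvu⟩ := hkeep v (by simpa [hva] using hv)
        exact ⟨u, fun h => hu (Finset.mem_of_mem_erase h), hvu⟩
  by_cases hxA : ∃ u ∈ S, u ≠ x ∧ u ≠ y ∧ u ≠ w ∧ G.Adj x u
  swap
  · push Not at hxA
    refine single x hxS (Or.inl rfl) hdx hxA ?_
    rintro v (rfl | rfl | rfl)
    exacts [⟨w, hwS, hxw.ne', hxw⟩, ⟨w, hwS, hxw.ne', hyw⟩, ⟨y, hyS, hne.symm, hyw.symm⟩]
  by_cases hyA : ∃ u ∈ S, u ≠ x ∧ u ≠ y ∧ u ≠ w ∧ G.Adj y u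
  swap
  · push Not at hyA
    refine single y hyS (Or.inr (Or.inl rfl)) hdy hyA ?_
    rintro v (rfl | rfl | rfl)
    exacts [⟨w, hwS, hyw.ne', hxw⟩, ⟨w, hwS, hyw.ne', hyw⟩, ⟨x, hxS, hne, hxw.symm⟩]
  -- The middle vertex comes last: dropping it requires `x` and `y` to be dominated from off the
  -- path.
  by_cases hwA : ∃ u ∈ S, u ≠ x ∧ u ≠ y ∧ u ≠ w ∧ G.Adj w u
  swap
  · push Not at hwA
    obtain ⟨p, hp, -, -, hpw, hxp⟩ := hxA
    obtain ⟨q, hq, -, -, hqw, hyq⟩ := hyA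
    refine single w hwS (Or.inr (Or.inr rfl)) hdw hwA ?_
    rintro v (rfl | rfl | rfl)
    exacts [⟨p, hp, hpw, hxp⟩, ⟨q, hq, hqw, hyq⟩, ⟨x, hxS, hxw.ne, hxw.symm⟩]
  -- All three have neighbours in `S` off the path, so the whole path can be dropped; its own edges
  -- supply the neighbours outside the set.
  refine ⟨S \ {x, y, w}, ⟨fun v => ?_, fun v hv => ?_⟩, ?_⟩
  · have : ∃ u ∈ S, u ≠ x ∧ u ≠ y ∧ u ≠ w ∧ G.Adj v u := by
      by_cases hv : v = x ∨ v = y ∨ v = w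
      · rcases hv with rfl | rfl | rfl <;> assumption
      · push Not at hv
        exact hdom v hv.1 hv.2.1 hv.2.2
    obtain ⟨u, hu, h1, h2, h3, hvu⟩ := this
    exact ⟨u, by simp [*], hvu⟩
  · by_cases hv' : v = x ∨ v = y ∨ v = w
    · rcases hv' with rfl | rfl | rfl
      exacts [⟨w, by simp, hxw⟩, ⟨w, by simp, hyw⟩, ⟨x, by simp, hxw.symm⟩]
    · obtain ⟨u, hu, hvu⟩ := hkeep v fun h => hv (by simpa [h] using hv')
      exact ⟨u, by simp [hu], hvu⟩
  · exact Finset.card_lt_card (Finset.ssubset_iff_subset_ne.2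
      ⟨Finset.sdiff_subset, fun h => by have := h ▸ hxS; simp at this⟩)

open Classical in
/-- Isolating an edge `xy` and turning a further neighbour `z` of `x` into a leaf. -/
theorem bondage_adj (hδ : 4 ≤ G.minDegree) {x y : V} (hxy : G.Adj x y) :
    ∃ E, IsTotalRestrainedBondageSet G E ∧ E.card + 4 ≤ G.degree x + G.degree y + G.maxDegree := by
  have hd : ∀ v, 4 ≤ G.degree v := fun v => hδ.trans (G.minDegree_le_degree v)
  obtain ⟨z, hxz, hzy⟩ := exists_adj_notMem_of_card_lt_degree (G := G) (v := x) (A := {y})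
    (by have := hd x; simp; omega)
  obtain ⟨t, hzt, ht⟩ := exists_adj_notMem_of_card_lt_degree (G := G) (v := z) (A := {x, y})
    (by have := hd z; have := Finset.card_le_two (a := x) (b := y); omega)
  simp only [Finset.mem_singleton, Finset.mem_insert, not_or] at hzy ht
  obtain ⟨htx, hty⟩ := ht
  have hxy' := hxy.ne
  have hxz' := hxz.ne
  have hzt' := hzt.ne
  set E : Finset (Sym2 V) := (G.incidenceFinset x).erase s(x, y) ∪
      (G.incidenceFinset y).erase s(x, y) ∪
    (((G.incidenceFinset z).erase s(x, z)).erase s(z, t)) with hE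
  -- The three stars lose 1, 1 and 2 edges: `xy` is kept at both ends, `zt` is kept, and `xz` is
  -- already counted at `x`.
  have hcard : E.card + 4 ≤ G.degree x + G.degree y + G.degree z := by
    have h1 := Finset.card_union_le ((G.incidenceFinset x).erase s(x, y) ∪
        (G.incidenceFinset y).erase s(x, y))
      (((G.incidenceFinset z).erase s(x, z)).erase s(z, t))
    have h2 := Finset.card_union_le ((G.incidenceFinset x).erase s(x, y))
      ((G.incidenceFinset y).erase s(x, y))
    rw [Finset.card_erase_of_mem (by simp [incidenceSet, hxy]),
      Finset.card_erase_of_mem (by simp [incidenceSet, hxy]),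
      card_incidenceFinset_eq_degree, card_incidenceFinset_eq_degree] at h2
    rw [Finset.card_erase_of_mem (s := (G.incidenceFinset z).erase s(x, z)) (by
        simp [incidenceSet, hzt, htx, hxz'.symm]),
      Finset.card_erase_of_mem (s := G.incidenceFinset z) (by simp [incidenceSet, hxz]),
      card_incidenceFinset_eq_degree] at h1
    rw [← hE] at h1
    have := hd x; have := hd y; have := hd z
    omega
  have hadj : ∀ a b, (G.deleteEdges (E : Set (Sym2 V))).Adj a b ↔ G.Adj a b ∧ s(a, b) ∉ E := by
    intro a b; simp [deleteEdges_adj]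
  have hmem : ∀ e ∈ E, e ∈ G.edgeSet ∧ (x ∈ e ∨ y ∈ e ∨ z ∈ e) := by
    intro e he
    simp only [hE, Finset.mem_union, Finset.mem_erase, mem_incidenceFinset, incidenceSet] at he
    rcases he with (⟨-, h1, h2⟩ | ⟨-, h1, h2⟩) | ⟨-, -, h1, h2⟩ <;> simp [h1, h2]
  have hyz : ¬ y = z := fun h => hzy h.symm
  have hxyE : s(x, y) ∉ E := by simp [hE, incidenceSet, hxz'.symm, hzy, hxz', hyz]
  have hztE : s(z, t) ∉ E := by
    simp [hE, incidenceSet, hxz', hyz, Ne.symm htx, Ne.symm hty]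
  refine ⟨E, isTotalRestrainedBondageSet_of_reduction (fun e he => (hmem e he).1) (fun v => ?_)
    (fun S hS => hS.reduce_isolated_edge (deleteEdges_le _) hxy hxz hzy (by have := hd y; omega)
      (z := z) (t := t) (fun w hw => ?_) (fun w hw => ?_) (fun w hw => ?_)),
    hcard.trans (by have := G.degree_le_maxDegree z; omega)⟩
  · by_cases hvx : v = x
    · exact ⟨y, (hadj _ _).2 (hvx ▸ ⟨hxy, hxyE⟩)⟩
    by_cases hvy : v = y
    · exact ⟨x, (hadj _ _).2 ⟨hvy ▸ hxy.symm, by rw [hvy, Sym2.eq_swap]; exact hxyE⟩⟩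
    by_cases hvz : v = z
    · exact ⟨t, (hadj _ _).2 (hvz ▸ ⟨hzt, hztE⟩)⟩
    -- Every deleted edge meets `{x, y, z}`, so a vertex with four neighbours keeps one.
    obtain ⟨w, hvw, hw⟩ := exists_adj_notMem_of_card_lt_degree (G := G) (v := v) (A := {x, y, z})
      (by have := hd v; have := Finset.card_le_three (a := x) (b := y) (c := z); omega)
    refine ⟨w, (hadj v w).2 ⟨hvw, fun h => ?_⟩⟩
    have := (hmem _ h).2
    simp only [Finset.mem_insert, Finset.mem_singleton, not_or] at hw
    simp only [Sym2.mem_iff] at this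
    tauto
  · obtain ⟨h1, h2⟩ := (hadj _ _).1 hw
    by_contra hne
    exact h2 (by simp [hE, incidenceSet, h1, hne, hxy'])
  · obtain ⟨h1, h2⟩ := (hadj _ _).1 hw
    by_contra hne
    exact h2 (by simp [hE, incidenceSet, h1, hne, hxy'.symm])
  · obtain ⟨h1, h2⟩ := (hadj _ _).1 hw
    by_contra hne
    by_cases hwx : w = x
    · subst hwx
      exact h2 (by simp [hE, incidenceSet, h1, hzy, hzt', hxy'])
    · exact h2 (by simp [hE, incidenceSet, h1, hne, hwx, hxz'.symm, hzt'])

open Classical in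
/-- Isolating a path `xwy`. -/
theorem bondage_common_neighbor (hδ : 4 ≤ G.minDegree) {x y w : V} (hne : x ≠ y)
    (hxw : G.Adj x w) (hyw : G.Adj y w) :
    ∃ E, IsTotalRestrainedBondageSet G E ∧ E.card + 4 ≤ G.degree x + G.degree y + G.maxDegree := by
  have hd : ∀ v, 4 ≤ G.degree v := fun v => hδ.trans (G.minDegree_le_degree v)
  have hxw' := hxw.ne
  have hyw' := hyw.ne
  set E : Finset (Sym2 V) := (G.incidenceFinset x).erase s(x, w) ∪
      (G.incidenceFinset y).erase s(y, w) ∪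
    (((G.incidenceFinset w).erase s(x, w)).erase s(y, w)) with hE
  have hcard : E.card + 4 ≤ G.degree x + G.degree y + G.degree w := by
    have h1 := Finset.card_union_le ((G.incidenceFinset x).erase s(x, w) ∪
        (G.incidenceFinset y).erase s(y, w))
      (((G.incidenceFinset w).erase s(x, w)).erase s(y, w))
    have h2 := Finset.card_union_le ((G.incidenceFinset x).erase s(x, w))
      ((G.incidenceFinset y).erase s(y, w))
    rw [Finset.card_erase_of_mem (by simp [incidenceSet, hxw]),
      Finset.card_erase_of_mem (by simp [incidenceSet, hyw]),
      card_incidenceFinset_eq_degree, card_incidenceFinset_eq_degree] at h2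
    rw [Finset.card_erase_of_mem (s := (G.incidenceFinset w).erase s(x, w)) (by
        simp [incidenceSet, hyw, hne.symm, hyw']),
      Finset.card_erase_of_mem (s := G.incidenceFinset w) (by simp [incidenceSet, hxw]),
      card_incidenceFinset_eq_degree, ← hE] at h1
    have := hd x; have := hd y; have := hd w
    omega
  have hadj : ∀ a b, (G.deleteEdges (E : Set (Sym2 V))).Adj a b ↔ G.Adj a b ∧ s(a, b) ∉ E := by
    intro a b; simp [deleteEdges_adj]
  have hmem : ∀ e ∈ E, e ∈ G.edgeSet ∧ (x ∈ e ∨ y ∈ e ∨ w ∈ e) := by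
    intro e he
    simp only [hE, Finset.mem_union, Finset.mem_erase, mem_incidenceFinset, incidenceSet] at he
    rcases he with (⟨-, h1, h2⟩ | ⟨-, h1, h2⟩) | ⟨-, -, h1, h2⟩ <;> simp [h1, h2]
  have hxwE : s(x, w) ∉ E := by simp [hE, incidenceSet, hne, hne.symm, hyw', hxw']
  have hywE : s(y, w) ∉ E := by simp [hE, incidenceSet, hne, hne.symm, hyw', hxw']
  refine ⟨E, isTotalRestrainedBondageSet_of_reduction (fun e he => (hmem e he).1) (fun v => ?_)
    (fun S hS => hS.reduce_isolated_path (deleteEdges_le _) hxw hyw hne (by have := hd x; omega)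
      (by have := hd y; omega) (by have := hd w; omega)
      (fun v hv => ?_) (fun v hv => ?_) (fun v hv => ?_)),
    hcard.trans (by have := G.degree_le_maxDegree w; omega)⟩
  · by_cases hvx : v = x
    · exact ⟨w, (hadj _ _).2 (hvx ▸ ⟨hxw, hxwE⟩)⟩
    by_cases hvy : v = y
    · exact ⟨w, (hadj _ _).2 (hvy ▸ ⟨hyw, hywE⟩)⟩
    by_cases hvw : v = w
    · exact ⟨x, (hadj _ _).2 ⟨hvw ▸ hxw.symm, by rw [hvw, Sym2.eq_swap]; exact hxwE⟩⟩
    obtain ⟨u, hvu, hu⟩ := exists_adj_notMem_of_card_lt_degree (G := G) (v := v) (A := {x, y, w})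
      (by have := hd v; have := Finset.card_le_three (a := x) (b := y) (c := w); omega)
    refine ⟨u, (hadj v u).2 ⟨hvu, fun h => ?_⟩⟩
    have := (hmem _ h).2
    simp only [Finset.mem_insert, Finset.mem_singleton, not_or] at hu
    simp only [Sym2.mem_iff] at this
    tauto
  · obtain ⟨h1, h2⟩ := (hadj _ _).1 hv
    by_contra hn
    exact h2 (by simp [hE, incidenceSet, h1, hn, hxw'])
  · obtain ⟨h1, h2⟩ := (hadj _ _).1 hv
    by_contra hn
    exact h2 (by simp [hE, incidenceSet, h1, hn, hyw'])
  · obtain ⟨h1, h2⟩ := (hadj _ _).1 hv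
    by_contra hn
    push Not at hn
    exact h2 (by simp [hE, incidenceSet, h1, hn, hyw'.symm, hxw'.symm])

end Bondage

/-! ### A close pair of vertices with degree sum at most twice the average. -/

section AverageDegree

variable {V : Type*} [Fintype V] {G : SimpleGraph V} [DecidableRel G.Adj]

theorem sum_degree_eq_averageDegree_mul [Nonempty V] :
    ∑ v, (G.degree v : ℝ) = averageDegree G * Fintype.card V := by
  have h : (Fintype.card V : ℝ) ≠ 0 := by exact_mod_cast Fintype.card_ne_zero
  rw [averageDegree, div_mul_cancel₀ _ h]
  exact_mod_cast G.sum_degrees_eq_twice_card_edges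

/-- Two vertices at distance at most two with degree sum at most twice the average degree. -/
theorem exists_degree_add_le_two_mul_averageDegree [Nonempty V] (h1 : ∀ v, 1 ≤ G.degree v) :
    ∃ x y, x ≠ y ∧ (G.Adj x y ∨ ∃ w, G.Adj x w ∧ G.Adj y w) ∧
      (G.degree x + G.degree y : ℝ) ≤ 2 * averageDegree G := by
  classical
  by_contra! hcon
  set a := averageDegree G with ha
  have hnb : ∀ v, ∃ w, G.Adj v w := fun v => (G.degree_pos_iff_exists_adj v).1 (h1 v)
  choose φ hφ using hnb
  set L : Finset V := Finset.univ.filter fun v => (G.degree v : ℝ) ≤ a with hL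
  have hmemL : ∀ v, v ∈ L ↔ (G.degree v : ℝ) ≤ a := by simp [hL]
  have hpair : ∀ v, 2 * a < G.degree v + G.degree (φ v) := fun v =>
    hcon v (φ v) (hφ v).ne (Or.inl (hφ v))
  -- Two low-degree vertices with the same chosen neighbour would be a pair at distance at most two
  -- with degree sum at most `2 * a`.
  have hinj : Set.InjOn φ L := by
    intro v hv w hw hvw
    by_contra hne
    have := hcon v w hne (Or.inr ⟨φ v, hφ v, hvw ▸ hφ w⟩)
    have h1 := (hmemL v).1 hv
    have h2 := (hmemL w).1 hw
    linarith
  have hdisj : Disjoint L (L.image φ) := by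
    rw [Finset.disjoint_left]
    intro u hu hu'
    obtain ⟨v, hv, rfl⟩ := Finset.mem_image.1 hu'
    have := hpair v
    have h1 := (hmemL _).1 hv
    have h2 := (hmemL _).1 hu
    linarith
  have hsum0 : ∑ v, ((G.degree v : ℝ) - a) = 0 := by
    rw [Finset.sum_sub_distrib, sum_degree_eq_averageDegree_mul]
    simp [ha, mul_comm]
  have hLne : L.Nonempty := by
    by_contra hempty
    rw [Finset.not_nonempty_iff_eq_empty] at hempty
    have : 0 < ∑ v, ((G.degree v : ℝ) - a) := by
      refine Finset.sum_pos (fun v _ => ?_) Finset.univ_nonempty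
      have : v ∉ L := by simp [hempty]
      rw [hmemL] at this
      linarith
    linarith
  -- Each deficit in `L` is more than paid for by the excess at its own partner `φ v`, contradicting
  -- the total excess 0.
  have hpos : 0 < ∑ v ∈ L ∪ L.image φ, ((G.degree v : ℝ) - a) := by
    rw [Finset.sum_union hdisj, Finset.sum_image hinj, ← Finset.sum_add_distrib]
    refine Finset.sum_pos (fun v _ => ?_) hLne
    have := hpair v
    linarith
  have hle : ∑ v ∈ L ∪ L.image φ, ((G.degree v : ℝ) - a) ≤ ∑ v, ((G.degree v : ℝ) - a) := by
    refine Finset.sum_le_sum_of_subset_of_nonneg (Finset.subset_univ _) fun v _ hv => ?_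
    have : v ∉ L := fun h => hv (Finset.mem_union_left _ h)
    rw [hmemL] at this
    linarith
  linarith

end AverageDegree

/-- The range of `Φ` is orthogonal to the range of the injective map `Ψ`. -/
theorem finrank_range_add_finrank_le_of_dotProduct_eq_zero {K ι A B : Type*} [Field K] [Fintype ι]
    [AddCommGroup A] [Module K A] [AddCommGroup B] [Module K B] [FiniteDimensional K B]
    (Φ : A →ₗ[K] ι → K) (Ψ : B →ₗ[K] ι → K) (hΨ : Function.Injective Ψ)
    (h : ∀ a b, Φ a ⬝ᵥ Ψ b = 0) :
    Module.finrank K (LinearMap.range Φ) + Module.finrank K B ≤ Fintype.card ι := by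
  classical
  -- The kernel of `T` is the orthogonal complement of the range of `Ψ`; its codimension is dim B
  -- because `Ψ` is injective.
  let T : (ι → K) →ₗ[K] Module.Dual K B := Ψ.dualMap ∘ₗ (dotProductEquiv K ι).toLinearMap
  have hT : Function.Surjective T :=
    (LinearMap.dualMap_surjective_of_injective hΨ).comp (dotProductEquiv K ι).surjective
  have hle : LinearMap.range Φ ≤ LinearMap.ker T := by
    rintro _ ⟨a, rfl⟩
    rw [LinearMap.mem_ker]
    ext b
    simpa [T] using h a b
  have h1 := LinearMap.finrank_range_add_finrank_ker T
  rw [LinearMap.range_eq_top.2 hT, finrank_top, Subspace.dual_finrank_eq,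
    Module.finrank_fintype_fun_eq_card] at h1
  have := Submodule.finrank_mono hle
  omega

/-! ### Chains modulo 2 on a polygonal surface, and cutting along edges. -/

namespace PolygonalSurface

variable {F : Type} (M : PolygonalSurface F)

/-- The edge of a flag. -/
def edgeOf (x : F) : M.Edge := Quot.mk _ x

/-- The face of a flag. -/
def faceOf (x : F) : M.Face := Quot.mk _ x

theorem vertexOf_r₁ (x : F) : M.vertexOf (M.r₁ x) = M.vertexOf x := by
  symm; exact Quot.sound (Or.inl rfl)

theorem vertexOf_r₂ (x : F) : M.vertexOf (M.r₂ x) = M.vertexOf x := by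
  symm; exact Quot.sound (Or.inr rfl)

theorem faceOf_r₀ (x : F) : M.faceOf (M.r₀ x) = M.faceOf x := by
  symm; exact Quot.sound (Or.inl rfl)

theorem faceOf_r₁ (x : F) : M.faceOf (M.r₁ x) = M.faceOf x := by
  symm; exact Quot.sound (Or.inr rfl)

theorem edgeOf_r₀ (x : F) : M.edgeOf (M.r₀ x) = M.edgeOf x := by
  symm; exact Quot.sound (Or.inl rfl)

theorem edgeOf_r₂ (x : F) : M.edgeOf (M.r₂ x) = M.edgeOf x := by
  symm; exact Quot.sound (Or.inr rfl)

theorem edgeOf_out (e : M.Edge) : M.edgeOf (Quot.out e) = e := Quot.out_eq e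

/-- As `r₀` and `r₂` are commuting involutions, the four listed flags are closed under both, so this
set descends to the quotient. -/
theorem edgeOf_eq_iff {x y : F} : M.edgeOf y = M.edgeOf x ↔
    y = x ∨ y = M.r₀ x ∨ y = M.r₂ x ∨ y = M.r₀ (M.r₂ x) := by
  constructor
  · intro h
    let orbit : F → Set F := fun x => {y | y = x ∨ y = M.r₀ x ∨ y = M.r₂ x ∨ y = M.r₀ (M.r₂ x)}
    have horb : ∀ a b, (b = M.r₀ a ∨ b = M.r₂ a) → orbit a = orbit b := by
      rintro a b (rfl | rfl)
      · ext y
        simp only [orbit, Set.mem_ofPred_eq, M.invol₀, ← M.comm]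
        tauto
      · ext y
        simp only [orbit, Set.mem_ofPred_eq, M.invol₂]
        tauto
    have : orbit y = orbit x := congrArg (Quot.lift orbit horb) h
    have hy : y ∈ orbit y := Or.inl rfl
    rw [this] at hy
    exact hy
  · rintro (rfl | rfl | rfl | rfl) <;> simp [edgeOf_r₀, edgeOf_r₂]

/-- Makes the sum over the two sides of an edge independent of the representative `Quot.out`;
`end_sum_eq` does the same for the two ends. -/
theorem side_sum_eq {a : F → ZMod 2} (h₀ : ∀ x, a (M.r₀ x) = a x) {x y : F}
    (h : M.edgeOf y = M.edgeOf x) : a y + a (M.r₂ y) = a x + a (M.r₂ x) := by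
  rcases M.edgeOf_eq_iff.1 h with rfl | rfl | rfl | rfl
  · rfl
  · rw [← M.comm, h₀, h₀]
  · rw [M.invol₂, add_comm]
  · rw [← M.comm (M.r₂ x), h₀, h₀, M.invol₂, add_comm]

theorem end_sum_eq {b : F → ZMod 2} (h₂ : ∀ x, b (M.r₂ x) = b x) {x y : F}
    (h : M.edgeOf y = M.edgeOf x) : b y + b (M.r₀ y) = b x + b (M.r₀ x) := by
  rcases M.edgeOf_eq_iff.1 h with rfl | rfl | rfl | rfl
  · rfl
  · rw [M.invol₀, add_comm]
  · rw [M.comm, h₂, h₂]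
  · rw [M.invol₀, M.comm, h₂, h₂, add_comm]

theorem ends_eq {x y : F} (h : M.edgeOf y = M.edgeOf x) :
    s(M.vertexOf y, M.vertexOf (M.r₀ y)) = s(M.vertexOf x, M.vertexOf (M.r₀ x)) := by
  rcases M.edgeOf_eq_iff.1 h with rfl | rfl | rfl | rfl
  · rfl
  · rw [M.invol₀, Sym2.eq_swap]
  · rw [M.comm, vertexOf_r₂, vertexOf_r₂]
  · rw [M.invol₀, M.comm, vertexOf_r₂, vertexOf_r₂, Sym2.eq_swap]

theorem eq_of_invariant {α : Type*} {c : F → α} (h₀ : ∀ x, c (M.r₀ x) = c x)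
    (h₁ : ∀ x, c (M.r₁ x) = c x) (h₂ : ∀ x, c (M.r₂ x) = c x) (x y : F) : c x = c y := by
  induction M.connected x y with
  | rel a b h => rcases h with rfl | rfl | rfl <;> simp [*]
  | refl => rfl
  | symm _ _ _ ih => exact ih.symm
  | trans _ _ _ _ _ ih₁ ih₂ => exact ih₁.trans ih₂

instance [Finite F] : Finite M.Vertex := inferInstanceAs (Finite (Quot _))
instance [Finite F] : Finite M.Edge := inferInstanceAs (Finite (Quot _))
instance [Finite F] : Finite M.Face := inferInstanceAs (Finite (Quot _))

/-- The boundary of a `2`-chain is orthogonal to the coboundary of a `0`-cochain. -/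
theorem sum_side_mul_end_eq_zero [Fintype F] [Fintype M.Edge] {a b : F → ZMod 2}
    (ha₀ : ∀ x, a (M.r₀ x) = a x) (ha₁ : ∀ x, a (M.r₁ x) = a x)
    (hb₁ : ∀ x, b (M.r₁ x) = b x) (hb₂ : ∀ x, b (M.r₂ x) = b x) :
    ∑ e : M.Edge, (a (Quot.out e) + a (M.r₂ (Quot.out e))) *
      (b (Quot.out e) + b (M.r₀ (Quot.out e))) = 0 := by
  classical
  -- Multiplying out (two sides) × (two ends) gives one term for each of the four flags of the edge.
  have hfib : ∀ e : M.Edge, ∑ y with M.edgeOf y = e, a y * b y =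
      (a (Quot.out e) + a (M.r₂ (Quot.out e))) * (b (Quot.out e) + b (M.r₀ (Quot.out e))) := by
    intro e
    set x := Quot.out e with hx
    have he : e = M.edgeOf x := (M.edgeOf_out e).symm
    have hset : (Finset.univ.filter fun y => M.edgeOf y = e) =
        {x, M.r₀ x, M.r₂ x, M.r₀ (M.r₂ x)} := by
      ext y
      simp [he, edgeOf_eq_iff]
    have h02 : M.r₀ x ≠ M.r₂ x := fun h => M.ne₀₂ x (by rw [← h, M.invol₀])
    rw [hset, Finset.sum_insert, Finset.sum_insert, Finset.sum_insert, Finset.sum_singleton,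
      ha₀, ha₀, hb₂, M.comm, hb₂]
    · ring
    · simpa using (M.ne₀ (M.r₂ x)).symm
    · simpa [h02] using (M.ne₂ x).symm
    · simp [(M.ne₀ x).symm, (M.ne₂ x).symm, (M.ne₀₂ x).symm]
  rw [← Finset.sum_congr rfl fun e _ => hfib e,
    Finset.sum_fiberwise Finset.univ M.edgeOf fun y => a y * b y]
  -- Flags paired by `r₁` have the same vertex and face, hence equal terms, which cancel modulo 2.
  refine Finset.sum_involution (fun y _ => M.r₁ y) (fun y _ => ?_) (fun y _ _ => M.ne₁ y)
    (fun y _ => Finset.mem_univ _) (fun y _ => M.invol₁ y)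
  rw [ha₁, hb₁]
  exact CharTwo.add_self_eq_zero _

section Regions

variable (T : Set M.Edge)

/-- The parts into which the surface falls when it is cut along the edges in `T`. -/
def Region : Type :=
  Quot (fun a b : F => b = M.r₀ a ∨ b = M.r₁ a ∨ (b = M.r₂ a ∧ M.edgeOf a ∉ T))

/-- The region of a flag. -/
def regionOf (x : F) : M.Region T := Quot.mk _ x

instance [Finite F] : Finite (M.Region T) := inferInstanceAs (Finite (Quot _))

theorem regionOf_r₀ (x : F) : M.regionOf T (M.r₀ x) = M.regionOf T x := by
  symm; exact Quot.sound (Or.inl rfl)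

theorem regionOf_r₁ (x : F) : M.regionOf T (M.r₁ x) = M.regionOf T x := by
  symm; exact Quot.sound (Or.inr (Or.inl rfl))

theorem regionOf_r₂ {x : F} (h : M.edgeOf x ∉ T) : M.regionOf T (M.r₂ x) = M.regionOf T x := by
  symm; exact Quot.sound (Or.inr (Or.inr ⟨rfl, h⟩))

/-- Cutting along the edges in `T`, whose ends lie in `U`, produces at least
`χ + |T| - |U|` regions. -/
theorem eulerChar_add_card_le [Finite F] {U : Set M.Vertex} (hU : U.Nonempty)
    (hT : ∀ x, M.edgeOf x ∈ T → M.vertexOf x ∈ U) :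
    M.eulerChar + Nat.card T ≤ Nat.card U + Nat.card (M.Region T) := by
  classical
  have := Fintype.ofFinite F
  have := Fintype.ofFinite M.Edge
  have := Fintype.ofFinite M.Face
  have := Fintype.ofFinite M.Vertex
  have := Fintype.ofFinite (M.Region T)
  -- `Φ` is the boundary of 2-chains read off `T`, so its kernel has dimension at most #regions. `δ`
  -- is the coboundary of vertex functions; those extended by zero over `U` make it injective and
  -- vanish at the ends of edges in `T`. Orthogonality then gives (#faces - #regions) + (#vertices -
  -- |U|) ≤ #edges - |T|.
  let Φ : (M.Face → ZMod 2) →ₗ[ZMod 2] ({e : M.Edge // e ∉ T} → ZMod 2) :=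
    { toFun := fun a e => a (M.faceOf (Quot.out e.1)) + a (M.faceOf (M.r₂ (Quot.out e.1)))
      map_add' := fun a b => by ext e; simp only [Pi.add_apply]; ring
      map_smul' := fun c a => by ext e; simp [mul_add] }
  let δ : (M.Vertex → ZMod 2) →ₗ[ZMod 2] ({e : M.Edge // e ∉ T} → ZMod 2) :=
    { toFun := fun b e => b (M.vertexOf (Quot.out e.1)) + b (M.vertexOf (M.r₀ (Quot.out e.1)))
      map_add' := fun a b => by ext e; simp only [Pi.add_apply]; ring
      map_smul' := fun c a => by ext e; simp [mul_add] }
  let ext0 : ({v : M.Vertex // v ∉ U} → ZMod 2) →ₗ[ZMod 2] (M.Vertex → ZMod 2) :=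
    Function.ExtendByZero.linearMap (ZMod 2) Subtype.val
  have hext0 : ∀ b v, v ∈ U → ext0 b v = 0 := by
    intro b v hv
    have : ¬ ∃ w : {v : M.Vertex // v ∉ U}, w.1 = v := by
      rintro ⟨w, rfl⟩; exact w.2 hv
    simp [ext0, Function.extend_apply' _ _ _ this]
  have hT' : ∀ x, M.edgeOf x ∈ T → M.vertexOf (M.r₀ x) ∈ U := fun x hx =>
    hT _ (by rwa [edgeOf_r₀])
  have hΨ : Function.Injective (δ ∘ₗ ext0) := by
    rw [← LinearMap.ker_eq_bot, LinearMap.ker_eq_bot']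
    intro b hb
    -- A zero coboundary makes the function constant on the connected surface, and it is 0 somewhere
    -- because `U` is nonempty.
    have hinv : ∀ x, ext0 b (M.vertexOf (M.r₀ x)) = ext0 b (M.vertexOf x) := by
      intro x
      by_cases hx : M.edgeOf x ∈ T
      · rw [hext0 b _ (hT x hx), hext0 b _ (hT' x hx)]
      · have h1 := congrFun hb ⟨M.edgeOf x, hx⟩
        have h2 := M.end_sum_eq (b := fun x => ext0 b (M.vertexOf x))
          (fun x => by rw [vertexOf_r₂]) (M.edgeOf_out (M.edgeOf x))
        have h3 : ext0 b (M.vertexOf x) + ext0 b (M.vertexOf (M.r₀ x)) = 0 := h2.symm.trans h1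
        exact (CharTwo.add_eq_zero.1 h3).symm
    obtain ⟨u, hu⟩ := hU
    obtain ⟨y, rfl⟩ := Quot.exists_rep u
    funext v
    obtain ⟨x, hx⟩ := Quot.exists_rep v.1
    have h1 : ext0 b (M.vertexOf x) = ext0 b (M.vertexOf y) :=
      M.eq_of_invariant (c := fun x => ext0 b (M.vertexOf x)) hinv
        (fun x => by rw [vertexOf_r₁]) (fun x => by rw [vertexOf_r₂]) x y
    replace h1 := h1.trans (hext0 b _ hu)
    have h2 : ext0 b v.1 = b v := Subtype.val_injective.extend_apply b 0 v
    rw [← h2, ← hx]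
    exact h1
  have horth : ∀ a b, Φ a ⬝ᵥ (δ ∘ₗ ext0) b = 0 := by
    intro a b
    have h := M.sum_side_mul_end_eq_zero (a := fun x => a (M.faceOf x))
      (b := fun x => ext0 b (M.vertexOf x)) (fun x => by rw [faceOf_r₀])
      (fun x => by rw [faceOf_r₁]) (fun x => by rw [vertexOf_r₁]) (fun x => by rw [vertexOf_r₂])
    rw [← h]
    refine Fintype.sum_of_injective Subtype.val Subtype.val_injective _ _ (fun e he => ?_)
      fun e => rfl
    have heT : M.edgeOf (Quot.out e) ∈ T := by
      rw [M.edgeOf_out]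
      by_contra hn
      exact he ⟨⟨e, hn⟩, rfl⟩
    rw [hext0 b _ (hT _ heT), hext0 b _ (hT' _ heT), add_zero, mul_zero]
  have hrank := finrank_range_add_finrank_le_of_dotProduct_eq_zero Φ (δ ∘ₗ ext0) hΨ horth
  -- functions in the kernel of `Φ` are constant on every region
  have hker : ∀ a : LinearMap.ker Φ, ∀ x y : F,
      (y = M.r₀ x ∨ y = M.r₁ x ∨ (y = M.r₂ x ∧ M.edgeOf x ∉ T)) →
      a.1 (M.faceOf x) = a.1 (M.faceOf y) := by
    rintro ⟨a, ha⟩ x y (rfl | rfl | ⟨rfl, hx⟩)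
    · rw [faceOf_r₀]
    · rw [faceOf_r₁]
    · have h1 := congrFun (LinearMap.mem_ker.1 ha) ⟨M.edgeOf x, hx⟩
      have h2 := M.side_sum_eq (a := fun x => a (M.faceOf x))
        (fun x => by rw [faceOf_r₀]) (M.edgeOf_out (M.edgeOf x))
      exact CharTwo.add_eq_zero.1 (h2.symm.trans h1)
  let Q : LinearMap.ker Φ →ₗ[ZMod 2] (M.Region T → ZMod 2) :=
    { toFun := fun a => Quot.lift (fun x => a.1 (M.faceOf x)) (hker a)
      map_add' := fun a b => by funext ρ; induction ρ using Quot.ind; rfl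
      map_smul' := fun c a => by funext ρ; induction ρ using Quot.ind; rfl }
  have hQ : Function.Injective Q := by
    intro a b hab
    ext φ
    induction φ using Quot.ind with
    | mk x => exact congrFun hab (M.regionOf T x)
  have hdim := LinearMap.finrank_le_finrank_of_injective hQ
  have hsum := LinearMap.finrank_range_add_finrank_ker Φ
  rw [Module.finrank_fintype_fun_eq_card] at hdim hsum hrank
  have hV := Fintype.card_subtype_compl (fun v => v ∈ U)
  have hE := Fintype.card_subtype_compl (fun e => e ∈ T)
  have hV' := Fintype.card_subtype_le (fun v => v ∈ U)
  have hE' := Fintype.card_subtype_le (fun e => e ∈ T)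
  have hTc : Nat.card T = Fintype.card {e // e ∈ T} := Nat.card_eq_fintype_card
  have hUc : Nat.card U = Fintype.card {v // v ∈ U} := Nat.card_eq_fintype_card
  rw [eulerChar, hTc, hUc]
  simp only [Nat.card_eq_fintype_card]
  omega

end Regions

end PolygonalSurface

/-! ### The combinatorial trace of a drawing. -/

open Classical in
/-- The regions into which a drawing of `G` divides a surface, with the two sides of every edge. -/
structure RegionSystem {V : Type*} [Fintype V] (G : SimpleGraph V) (χ : ℤ) where
  Region : Type
  fintype : Fintype Region
  left : Sym2 V → Region
  right : Sym2 V → Region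
  euler : χ + G.edgeFinset.card ≤ Fintype.card V + Fintype.card Region
  even_boundary : ∀ ρ v,
    Even (G.edgeFinset.filter fun e => v ∈ e ∧ ¬ (left e = ρ ↔ right e = ρ)).card
  eq_of_boundary_empty : ∀ ρ, (∀ e ∈ G.edgeSet, (left e = ρ ↔ right e = ρ)) → ∀ σ, σ = ρ

open Classical in
theorem ite_add_ite_eq_ite_mem {α β : Type*} {f : α → β} (hf : Function.Injective f) {u w : α}
    (hne : u ≠ w) (v : α) : ((if f u = f v then 1 else 0) + (if f w = f v then 1 else 0) : ZMod 2) =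
      if v ∈ s(u, w) then 1 else 0 := by
  simp only [hf.eq_iff, Sym2.mem_iff]
  by_cases hu : u = v
  · subst hu; simp [hne.symm]
  by_cases hw : w = v
  · subst hw; simp [hne]
  simp [hu, hw, Ne.symm hu, Ne.symm hw]

theorem PolygonalSurface.Carries.exists_regionSystem {F : Type} [Finite F]
    {M : PolygonalSurface F} {V : Type*} [Fintype V] [Nonempty V] {G : SimpleGraph V}
    (h : M.Carries G) : Nonempty (RegionSystem G M.eulerChar) := by
  classical
  have := Fintype.ofFinite F
  have := Fintype.ofFinite M.Edge
  obtain ⟨f, hf, hfadj⟩ := h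
  have hflag : ∀ e : G.edgeSet, ∃ x : F, s(M.vertexOf x, M.vertexOf (M.r₀ x)) = e.1.map f := by
    rintro ⟨e, he⟩
    induction e with
    | _ v w =>
      obtain ⟨x, h1, h2⟩ := hfadj v w he
      exact ⟨x, by rw [h1, h2]; rfl⟩
  choose x hx using hflag
  have hinj : Function.Injective fun e => M.edgeOf (x e) := by
    intro e e' he
    have := M.ends_eq he
    rw [hx, hx] at this
    exact Subtype.ext (Sym2.map.injective hf this)
  set T : Set M.Edge := Set.range fun e => M.edgeOf (x e) with hT
  let := Fintype.ofFinite (M.Region T)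
  -- The values off `G.edgeSet` are arbitrary: all conditions concern edges only.
  let l : Sym2 V → M.Region T := fun e =>
    if h : e ∈ G.edgeSet then M.regionOf T (x ⟨e, h⟩)
    else M.regionOf T (Classical.choice M.nonempty)
  let r : Sym2 V → M.Region T := fun e =>
    if h : e ∈ G.edgeSet then M.regionOf T (M.r₂ (x ⟨e, h⟩))
    else M.regionOf T (Classical.choice M.nonempty)
  have hl : ∀ e : G.edgeSet, l e = M.regionOf T (x e) := fun e => dif_pos e.2
  have hr : ∀ e : G.edgeSet, r e = M.regionOf T (M.r₂ (x e)) := fun e => dif_pos e.2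
  let a : M.Region T → F → ZMod 2 := fun ρ y => if M.regionOf T y = ρ then 1 else 0
  have ha₀ : ∀ ρ y, a ρ (M.r₀ y) = a ρ y := fun ρ y => by simp only [a, M.regionOf_r₀]
  have ha₁ : ∀ ρ y, a ρ (M.r₁ y) = a ρ y := fun ρ y => by simp only [a, M.regionOf_r₁]
  have haT : ∀ ρ y, M.edgeOf y ∉ T → a ρ (M.r₂ y) = a ρ y := fun ρ y hy => by
    simp only [a, M.regionOf_r₂ T hy]
  have haside : ∀ ρ (e : G.edgeSet), a ρ (x e) + a ρ (M.r₂ (x e)) =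
      if (l e = ρ ↔ r e = ρ) then 0 else 1 := by
    intro ρ e
    rw [hl, hr]
    simp only [a]
    by_cases h1 : M.regionOf T (x e) = ρ <;> by_cases h2 : M.regionOf T (M.r₂ (x e)) = ρ <;>
      simp [h1, h2, CharTwo.add_self_eq_zero]
  refine ⟨⟨M.Region T, inferInstance, l, r, ?_, fun ρ v => ?_, fun ρ hρ σ => ?_⟩⟩
  · have h := M.eulerChar_add_card_le T (U := Set.range f) (Set.range_nonempty f) (fun y hy => ?_)
    · rw [hT, Nat.card_range_of_injective hinj, Nat.card_range_of_injective hf] at h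
      simp only [Nat.card_eq_fintype_card] at h
      rwa [edgeFinset_card]
    · obtain ⟨e, he⟩ := hy
      have h1 := M.ends_eq he
      rw [hx] at h1
      have h2 : M.vertexOf y ∈ e.1.map f := by rw [h1]; simp
      obtain ⟨v, -, hv⟩ := Sym2.mem_map.1 h2
      exact ⟨v, hv⟩
  · have h := M.sum_side_mul_end_eq_zero (a := a ρ)
      (b := fun y => if M.vertexOf y = f v then 1 else 0)
      (ha₀ ρ) (ha₁ ρ) (fun y => by rw [M.vertexOf_r₁]) (fun y => by rw [M.vertexOf_r₂])
    -- Off `T` the two sides lie in the same region, so only edges drawn from `G` contribute to the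
    -- orthogonality relation.
    rw [← Fintype.sum_of_injective (fun e => M.edgeOf (x e)) hinj
      (fun e => if v ∈ e.1 ∧ ¬ (l e = ρ ↔ r e = ρ) then 1 else 0) _ (fun e he => ?_)
      (fun e => ?_)] at h
    · rw [← ZMod.natCast_eq_zero_iff_even, ← h, Finset.card_filter, Nat.cast_sum,
        ← Finset.sum_coe_sort]
      refine Fintype.sum_equiv (Equiv.subtypeEquivRight fun e => by simp) _ _ fun e => ?_
      simp
    · rw [haT ρ _ (by rwa [M.edgeOf_out]), CharTwo.add_self_eq_zero, zero_mul]
    · rw [M.side_sum_eq (ha₀ ρ) (M.edgeOf_out _),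
        M.end_sum_eq (b := fun y => if M.vertexOf y = f v then (1 : ZMod 2) else 0)
          (fun y => by rw [M.vertexOf_r₂]) (M.edgeOf_out _), haside]
      have hends : ((if M.vertexOf (x e) = f v then 1 else 0) +
          (if M.vertexOf (M.r₀ (x e)) = f v then 1 else 0) : ZMod 2) =
          if v ∈ e.1 then 1 else 0 := by
        have h1 := hx e
        obtain ⟨e, he⟩ := e
        induction e with
        | _ u w =>
          have hne : u ≠ w := G.ne_of_adj he
          simp only [Sym2.map_mk, Sym2.eq_iff] at h1
          rcases h1 with ⟨h1, h2⟩ | ⟨h1, h2⟩ <;> rw [h1, h2]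
          · exact ite_add_ite_eq_ite_mem hf hne v
          · rw [add_comm]
            exact ite_add_ite_eq_ite_mem hf hne v
      rw [hends]
      by_cases h1 : v ∈ e.1 <;> by_cases h2 : (l e = ρ ↔ r e = ρ) <;> simp [h1, h2]
  -- With empty boundary the indicator of `ρ` is also unchanged across edges of `T`, hence constant
  -- by connectedness.
  · have hinv : ∀ y, a ρ (M.r₂ y) = a ρ y := by
      intro y
      by_cases hy : M.edgeOf y ∈ T
      · obtain ⟨e, he⟩ := hy
        have h1 := M.side_sum_eq (ha₀ ρ) he
        rw [haside, if_pos (hρ e e.2)] at h1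
        exact (CharTwo.add_eq_zero.1 h1.symm).symm
      · exact haT ρ y hy
    obtain ⟨y, rfl⟩ := Quot.exists_rep σ
    obtain ⟨z, rfl⟩ := Quot.exists_rep ρ
    have h1 := M.eq_of_invariant (ha₀ _) (ha₁ _) hinv y z
    have h2 : a (M.regionOf T z) z = 1 := if_pos rfl
    by_contra hne
    have h3 : a (M.regionOf T z) y = 0 := if_neg hne
    exact one_ne_zero (h2.symm.trans (h1.symm.trans h3))

/-! ### Leaves of finite forests. -/

section EvenSubgraph

variable {V : Type*} [Fintype V]

/-- The end of a longest path from `x` is a leaf: a further neighbour would close a cycle or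
lengthen the path. -/
theorem _root_.SimpleGraph.IsAcyclic.exists_degree_eq_one {H : SimpleGraph V} [DecidableRel H.Adj]
    (hH : H.IsAcyclic) {x y : V} (hxy : H.Adj x y) : ∃ v, H.degree v = 1 := by
  classical
  let P : ℕ → Prop := fun n => ∃ (v : V) (p : H.Walk x v), p.IsPath ∧ p.length = n
  have hP1 : P 1 := ⟨y, hxy.toWalk, by simp [hxy.ne], by simp⟩
  have hbound : ∀ n, P n → n ≤ Fintype.card V := by
    rintro n ⟨v, p, hp, rfl⟩
    exact hp.length_lt.le
  have hV : 1 ≤ Fintype.card V := hbound 1 hP1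
  obtain ⟨v, p, hp, hlen⟩ := Nat.findGreatest_spec (P := P) hV hP1
  have h1 : 1 ≤ p.length := hlen ▸ Nat.le_findGreatest hV hP1
  have hnil : ¬ p.Nil := by
    rw [← Walk.length_eq_zero_iff]; omega
  refine ⟨v, ?_⟩
  have hpen := p.adj_penultimate hnil
  refine le_antisymm ?_ ((H.degree_pos_iff_exists_adj v).2 ⟨_, hpen.symm⟩)
  by_contra! hlt
  obtain ⟨w, hvw, hw⟩ := exists_adj_notMem_of_card_lt_degree (G := H) (v := v)
    (A := {p.penultimate}) (by simpa using hlt)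
  have hsupp : w ∉ p.support := fun h =>
    hw (by simp [hH.eq_penultimate_of_adj_end hp hvw h])
  have hP : P (p.length + 1) := ⟨w, p.concat hvw, hp.concat hsupp hvw, by simp⟩
  have := Nat.le_findGreatest (hbound _ hP) hP
  omega

end EvenSubgraph

/-! ### Cycles along regions, and Euler's inequality with girth. -/

namespace RegionSystem

variable {V : Type*} [Fintype V] {G : SimpleGraph V} {χ : ℤ} (S : RegionSystem G χ)

instance : Fintype S.Region := S.fintype

open Classical in
/-- The number of sides of an edge that belong to a region. -/
noncomputable def sides (ρ : S.Region) (e : Sym2 V) : ℕ :=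
  (if S.left e = ρ then 1 else 0) + (if S.right e = ρ then 1 else 0)

theorem sum_sides (e : Sym2 V) : ∑ ρ, S.sides ρ e = 2 := by
  classical
  simp [sides, Finset.sum_add_distrib]

/-- The edges with exactly one side in `ρ` form an even subgraph. If it has an edge, it cannot be a
forest, since a leaf has odd degree. If it is empty, `ρ` is the only region and any cycle of `G`
serves. -/
theorem exists_cycle (hG : ¬ G.IsAcyclic) (ρ : S.Region) :
    ∃ (u : V) (c : G.Walk u u), c.IsCycle ∧ ∀ e ∈ c.edges, 1 ≤ S.sides ρ e := by
  classical
  by_cases hB : ∀ e ∈ G.edgeSet, (S.left e = ρ ↔ S.right e = ρ)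
  · have hall := S.eq_of_boundary_empty ρ hB
    simp only [IsAcyclic, not_forall, not_not] at hG
    obtain ⟨u, c, hc⟩ := hG
    exact ⟨u, c, hc, fun e _ => by simp [sides, hall]⟩
  · push Not at hB
    set B := G.edgeFinset.filter fun e => ¬ (S.left e = ρ ↔ S.right e = ρ) with hBdef
    set H : SimpleGraph V := fromEdgeSet (B : Set (Sym2 V)) with hHdef
    have hBG : ∀ e ∈ B, e ∈ G.edgeSet := fun e he => by
      simpa using (Finset.mem_filter.1 he).1
    have hHset : H.edgeSet = B := by
      rw [hHdef, edgeSet_fromEdgeSet, sdiff_eq_left, Set.disjoint_left]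
      exact fun e he => G.not_isDiag_of_mem_edgeSet (hBG e he)
    have hle : H ≤ G := by
      rw [← edgeSet_subset_edgeSet, hHset]
      exact hBG
    have heven : ∀ v, Even (H.degree v) := by
      intro v
      rw [← card_incidenceFinset_eq_degree]
      convert S.even_boundary ρ v using 2
      ext e
      have : e ∈ H.edgeSet ↔ e ∈ B := by rw [hHset]; simp
      simp only [mem_incidenceFinset, incidenceSet, Set.mem_sep_iff, this, hBdef,
        Finset.mem_filter]
      tauto
    have hcyc : ¬ H.IsAcyclic := by
      intro hac
      obtain ⟨e, he, hne⟩ := hB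
      have heB : e ∈ H.edgeSet := by
        rw [hHset]
        simp only [hBdef, Finset.coe_filter, mem_edgeFinset]
        exact ⟨he, by tauto⟩
      induction e with
      | _ x y =>
        obtain ⟨v, hv⟩ := hac.exists_degree_eq_one (x := x) (y := y) heB
        have := heven v
        rw [hv] at this
        exact absurd this (by decide)
    simp only [IsAcyclic, not_forall, not_not] at hcyc
    obtain ⟨u, c, hc⟩ := hcyc
    refine ⟨u, c.mapLe hle, hc.mapLe hle, fun e he => ?_⟩
    rw [Walk.edges_mapLe_eq_edges] at he
    have := c.edges_subset_edgeSet he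
    rw [hHset] at this
    have := (Finset.mem_filter.1 (Finset.mem_coe.1 this)).2
    unfold sides
    by_cases h1 : S.left e = ρ <;> by_cases h2 : S.right e = ρ <;> simp_all

variable [DecidableRel G.Adj]

theorem euler_le : χ + G.edgeFinset.card ≤ Fintype.card V + Fintype.card S.Region := by
  convert S.euler

theorem length_le_sum_sides {ρ : S.Region} {u : V} {c : G.Walk u u} (hc : c.IsCycle)
    (h : ∀ e ∈ c.edges, 1 ≤ S.sides ρ e) : c.length ≤ ∑ e ∈ G.edgeFinset, S.sides ρ e := by
  classical
  calc c.length = c.edges.toFinset.card := by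
        rw [List.toFinset_card_of_nodup hc.edges_nodup, Walk.length_edges]
    _ = ∑ e ∈ c.edges.toFinset, 1 := by simp
    _ ≤ ∑ e ∈ c.edges.toFinset, S.sides ρ e := Finset.sum_le_sum fun e he => h e (by simpa using he)
    _ ≤ _ := Finset.sum_le_sum_of_subset fun e he => by
        simpa using c.edges_subset_edgeSet (by simpa using he)

theorem girth_le_sum_sides (hG : ¬ G.IsAcyclic) (ρ : S.Region) :
    G.girth ≤ ∑ e ∈ G.edgeFinset, S.sides ρ e := by
  obtain ⟨u, c, hc, h⟩ := S.exists_cycle hG ρ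
  exact (girth_le_length hc).trans (S.length_le_sum_sides hc h)

theorem sum_sum_sides : ∑ ρ, ∑ e ∈ G.edgeFinset, S.sides ρ e = 2 * G.edgeFinset.card := by
  rw [Finset.sum_comm]
  simp [sum_sides, mul_comm]

theorem girth_mul_card_le (hG : ¬ G.IsAcyclic) :
    G.girth * Fintype.card S.Region ≤ 2 * G.edgeFinset.card := by
  rw [← S.sum_sum_sides, mul_comm, ← smul_eq_mul, ← Finset.card_univ]
  exact Finset.card_nsmul_le_sum _ _ _ fun ρ _ => S.girth_le_sum_sides hG ρ

/-- Euler's inequality for graphs of given girth. -/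
theorem girth_sub_two_mul_card_edges_le (S : RegionSystem G χ) (hG : ¬ G.IsAcyclic) :
    ((G.girth : ℝ) - 2) * G.edgeFinset.card ≤ G.girth * (Fintype.card V - χ) := by
  have h1 : (G.girth : ℝ) * Fintype.card S.Region ≤ 2 * G.edgeFinset.card := by
    exact_mod_cast S.girth_mul_card_le hG
  have h2 : (χ : ℝ) + G.edgeFinset.card ≤ Fintype.card V + Fintype.card S.Region := by
    exact_mod_cast S.euler_le
  have h3 : (0 : ℝ) ≤ G.girth := by positivity
  nlinarith

/-- A region has at least four sides or is bounded by a triangle. -/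
theorem four_le_or_triangle (hG : ¬ G.IsAcyclic) (ρ : S.Region) :
    4 ≤ ∑ e ∈ G.edgeFinset, S.sides ρ e ∨ ∃ x y z, G.Adj x y ∧ G.Adj y z ∧ G.Adj z x ∧
      ∑ e ∈ G.edgeFinset, S.sides ρ e = 3 ∧
      ∀ w : Sym2 V → ℝ, ∑ e ∈ G.edgeFinset, S.sides ρ e * w e =
        w s(x, y) + w s(y, z) + w s(z, x) := by
  classical
  obtain ⟨u, c, hc, h⟩ := S.exists_cycle hG ρ
  have hlen := S.length_le_sum_sides hc h
  have h3 := hc.three_le_length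
  by_cases h4 : 4 ≤ ∑ e ∈ G.edgeFinset, S.sides ρ e
  · exact Or.inl h4
  right
  have hk : ∑ e ∈ G.edgeFinset, S.sides ρ e = 3 := by omega
  have hc3 : c.length = 3 := by omega
  have hnd := hc.edges_nodup
  match c, hc3 with
  | .cons (v := y) hxy (.cons (v := z) hyz (.cons hzx .nil)), _ =>
    refine ⟨u, y, z, hxy, hyz, hzx, hk, fun w => ?_⟩
    simp only [Walk.edges_cons, Walk.edges_nil] at hnd h
    set L : List (Sym2 V) := [s(u, y), s(y, z), s(z, u)] with hL
    have hsub : L.toFinset ⊆ G.edgeFinset := by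
      intro e he
      simp only [hL, List.mem_toFinset, List.mem_cons, List.not_mem_nil, or_false] at he
      rcases he with rfl | rfl | rfl <;> simpa
    have hcardL : L.toFinset.card = 3 := by rw [List.toFinset_card_of_nodup hnd]; simp [hL]
    have hge : ∀ e ∈ G.edgeFinset, (if e ∈ L.toFinset then 1 else 0) ≤ S.sides ρ e := by
      intro e _
      split_ifs with he
      · exact h e (by simpa using he)
      · exact Nat.zero_le _
    have hsumL : ∑ e ∈ G.edgeFinset, (if e ∈ L.toFinset then 1 else 0) = 3 := by
      rw [← Finset.sum_filter, Finset.filter_mem_eq_inter, Finset.inter_eq_right.2 hsub]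
      simpa using hcardL
    -- The triangle already accounts for all three sides, so every edge of it counts once and no
    -- other edge counts.
    have heq := (Finset.sum_eq_sum_iff_of_le hge).1 (hsumL.trans hk.symm)
    rw [Finset.sum_congr rfl fun e he => by rw [← heq e he]]
    simp only [Nat.cast_ite, Nat.cast_one, Nat.cast_zero, ite_mul, one_mul, zero_mul]
    rw [← Finset.sum_filter, Finset.filter_mem_eq_inter, Finset.inter_eq_right.2 hsub,
      List.sum_toFinset _ hnd]
    simp [hL, add_assoc]

end RegionSystem

/-! ### Real inequalities for degrees. -/

section RealInequalities

theorem one_div_add_one_div_le {a b D : ℝ} (ha : 4 ≤ a) (hb : 4 ≤ b) (hab : D ≤ a + b)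
    (hD : 8 < D) : 1 / a + 1 / b ≤ 1 / 4 + 1 / (D - 4) := by
  rcases le_or_gt (D - 4) a with h | h
  · have h1 : 1 / a ≤ 1 / (D - 4) := one_div_le_one_div_of_le (by linarith) h
    have h2 : 1 / b ≤ 1 / 4 := one_div_le_one_div_of_le (by norm_num) hb
    linarith
  · have h1 : 1 / b ≤ 1 / (D - a) := one_div_le_one_div_of_le (by linarith) (by linarith)
    have h2 : 1 / a + 1 / (D - a) = D / (a * (D - a)) := by
      have : D - a ≠ 0 := by linarith
      field_simp; ring
    have h3 : 1 / 4 + 1 / (D - 4) = D / (4 * (D - 4)) := by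
      have : D - 4 ≠ 0 := by linarith
      field_simp; ring
    have h4 : D / (a * (D - a)) ≤ D / (4 * (D - 4)) :=
      div_le_div_of_nonneg_left (by linarith) (by nlinarith) (by nlinarith)
    linarith

/-- The left side is convex in `a`, so only the ends 4 and D/2 matter; the end 4 is the larger
exactly from D = 12 on, where both give 1/2. -/
theorem one_div_add_two_div_le {a D : ℝ} (ha : 4 ≤ a) (hD : 12 ≤ D) (haD : a ≤ D / 2) :
    1 / a + 2 / (D - a) ≤ 1 / 4 + 2 / (D - 4) := by
  have h1 : 1 / 4 - 1 / a = (a - 4) * (1 / (4 * a)) := by field_simp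
  have h2 : 2 / (D - a) - 2 / (D - 4) = (a - 4) * (2 / ((D - a) * (D - 4))) := by
    have : D - a ≠ 0 := by linarith
    have : D - 4 ≠ 0 := by linarith
    field_simp; ring
  have h3 : 2 / ((D - a) * (D - 4)) ≤ 1 / (4 * a) := by
    rw [div_le_div_iff₀ (by nlinarith) (by linarith)]
    nlinarith
  have := mul_le_mul_of_nonneg_left h3 (sub_nonneg.2 ha)
  linarith

theorem sum_one_div_le_of_min {a b c D : ℝ} (ha : 4 ≤ a) (hab' : a ≤ b) (hac' : a ≤ c)
    (hab : D ≤ a + b) (hac : D ≤ a + c) (hD : 12 ≤ D) :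
    1 / a + 1 / b + 1 / c ≤ 1 / 4 + 2 / (D - 4) := by
  rcases le_or_gt a (D / 2) with h | h
  · have h1 : 1 / b ≤ 1 / (D - a) := one_div_le_one_div_of_le (by linarith) (by linarith)
    have h2 : 1 / c ≤ 1 / (D - a) := one_div_le_one_div_of_le (by linarith) (by linarith)
    have h3 := one_div_add_two_div_le ha hD h
    have h4 : 2 / (D - a) = 1 / (D - a) + 1 / (D - a) := by ring
    linarith
  · have h0 : (0 : ℝ) < D / 2 := by linarith
    have h1 : 1 / a ≤ 1 / (D / 2) := one_div_le_one_div_of_le h0 h.le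
    have h2 : 1 / b ≤ 1 / (D / 2) := one_div_le_one_div_of_le h0 (by linarith)
    have h3 : 1 / c ≤ 1 / (D / 2) := one_div_le_one_div_of_le h0 (by linarith)
    have h4 := one_div_add_two_div_le (a := D / 2) (by linarith) hD le_rfl
    have h5 : 2 / (D - D / 2) = 1 / (D / 2) + 1 / (D / 2) := by
      rw [show D - D / 2 = D / 2 by ring]; ring
    linarith

theorem sum_one_div_le {a b c D : ℝ} (ha : 4 ≤ a) (hb : 4 ≤ b) (hc : 4 ≤ c)
    (hab : D ≤ a + b) (hbc : D ≤ b + c) (hca : D ≤ c + a) (hD : 12 ≤ D) :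
    1 / a + 1 / b + 1 / c ≤ 1 / 4 + 2 / (D - 4) := by
  rcases le_total a b with h1 | h1 <;> rcases le_total b c with h2 | h2 <;>
    rcases le_total a c with h3 | h3
  · exact sum_one_div_le_of_min ha h1 h3 hab (by linarith) hD
  · linarith [sum_one_div_le_of_min ha h1 (h1.trans h2) hab (by linarith) hD]
  · linarith [sum_one_div_le_of_min ha h1 h3 hab (by linarith) hD]
  · linarith [sum_one_div_le_of_min hc h3 h2 hca (by linarith) hD]
  · linarith [sum_one_div_le_of_min hb h1 h2 (by linarith) hbc hD]
  · linarith [sum_one_div_le_of_min hb h1 h2 (by linarith) hbc hD]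
  · linarith [sum_one_div_le_of_min hc (h2.trans h1) h2 hca (by linarith) hD]
  · linarith [sum_one_div_le_of_min hc h3 h2 hca (by linarith) hD]

/-- For d ≤ D/2 the bound d(2D + 1 - 3d) is concave, so its minimum is at an end. The first
alternative is its value at d = D/2, the smaller end while D ≤ 22; at d = 4 the value is 8D - 44, at
least 6D once D ≥ 22. Beyond D/2 the bound d(d + 1) takes over. -/
theorem six_mul_sub_le {d e D : ℝ} (hd : 4 ≤ d) (hde : d ≤ e) (he : D - d ≤ e) (hD : 16 ≤ D) :
    6 * D - 24 + (D - 6) * (D - 16) / 4 ≤ d * (2 * e + 1 - d) ∨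
      6 * D - 24 + 24 ≤ d * (2 * e + 1 - d) := by
  rcases le_total D (2 * d) with h | h
  · left; nlinarith
  · have h1 : d * (2 * D + 1 - 3 * d) ≤ d * (2 * e + 1 - d) :=
      mul_le_mul_of_nonneg_left (by linarith) (by linarith)
    have h2 : 0 ≤ (d - 4) * (D - 2 * d) := mul_nonneg (by linarith) (by linarith)
    rcases le_total D 22 with h3 | h3
    · left
      nlinarith [mul_nonneg (sub_nonneg.2 h) (sub_nonneg.2 h3)]
    · right
      nlinarith [mul_nonneg (by linarith : 0 ≤ d) (sub_nonneg.2 h3)]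

theorem four_mul_sub_le {d e D : ℝ} (hd : 4 ≤ d) (hde : d ≤ e) (he : D - d ≤ e) :
    4 * D - 24 ≤ d * (2 * e + 1 - d) := by
  rcases le_total D (2 * d) with h | h
  · nlinarith [sq_nonneg (D - 7)]
  · have h1 : d * (2 * D + 1 - 3 * d) ≤ d * (2 * e + 1 - d) :=
      mul_le_mul_of_nonneg_left (by linarith) (by linarith)
    have h2 : 0 ≤ (d - 4) * (D - 2 * d) := mul_nonneg (by linarith) (by linarith)
    rcases le_total D 22 with h3 | h3
    · nlinarith [mul_nonneg (sub_nonneg.2 h) (sub_nonneg.2 h3), sq_nonneg (D - 7)]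
    · nlinarith [mul_nonneg (by linarith : 0 ≤ d) (sub_nonneg.2 h3)]

end RealInequalities

/-! ### Edges of small degree sum, by discharging. -/

section LightEdges

theorem _root_.SimpleGraph.four_le_girth {V : Type*} {G : SimpleGraph V} (hG : ¬ G.IsAcyclic)
    (h : G.CliqueFree 3) : 4 ≤ G.girth := by
  have h3 := three_le_girth hG
  obtain ⟨u, c, hc, hlen⟩ := exists_girth_eq_length.2 hG
  by_contra hlt
  obtain ⟨s, hs⟩ := is3Clique_iff_exists_cycle_length_three.2 ⟨u, c, hc, by omega⟩
  exact h s hs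

variable {V : Type*} [Fintype V] {G : SimpleGraph V} [DecidableRel G.Adj]

theorem not_isAcyclic_of_two_le_degree [Nonempty V] (h : ∀ v, 2 ≤ G.degree v) :
    ¬ G.IsAcyclic := by
  intro hac
  obtain ⟨v⟩ := ‹Nonempty V›
  obtain ⟨w, hw⟩ := (G.degree_pos_iff_exists_adj v).1 (by have := h v; omega)
  obtain ⟨u, hu⟩ := hac.exists_degree_eq_one hw
  have := h u
  omega

/-- The sum of the reciprocals of the degrees of the ends of an edge. -/
noncomputable def recipDegreeSum (G : SimpleGraph V) [DecidableRel G.Adj] : Sym2 V → ℝ :=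
  Sym2.lift ⟨fun x y => 1 / (G.degree x : ℝ) + 1 / (G.degree y : ℝ), fun _ _ => add_comm _ _⟩

theorem sum_recipDegreeSum (h : ∀ v, 1 ≤ G.degree v) :
    ∑ e ∈ G.edgeFinset, recipDegreeSum G e = Fintype.card V := by
  classical
  have h1 : ∀ e ∈ G.edgeFinset, recipDegreeSum G e =
      ∑ v, if v ∈ e then 1 / (G.degree v : ℝ) else 0 := by
    intro e he
    induction e with
    | _ x y =>
      have hne : x ≠ y := G.ne_of_adj (by simpa using he)
      rw [← Finset.sum_filter,
        show (Finset.univ.filter fun v => v ∈ s(x, y)) = {x, y} by ext; simp,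
        Finset.sum_pair hne]
      rfl
  rw [Finset.sum_congr rfl h1, Finset.sum_comm]
  have h2 : ∀ v, (∑ e ∈ G.edgeFinset, if v ∈ e then 1 / (G.degree v : ℝ) else 0) = 1 := by
    intro v
    have hv : (G.degree v : ℝ) ≠ 0 := by have := h v; positivity
    rw [← Finset.sum_filter, ← incidenceFinset_eq_filter, Finset.sum_const,
      card_incidenceFinset_eq_degree, nsmul_eq_mul, mul_one_div_cancel hv]
  rw [Finset.sum_congr rfl fun v _ => h2 v]
  simp

theorem recipDegreeSum_le (hδ : ∀ v, 4 ≤ G.degree v) {D : ℝ} (hD : 8 < D)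
    (h : ∀ x y, G.Adj x y → D ≤ G.degree x + G.degree y) {e : Sym2 V} (he : e ∈ G.edgeFinset) :
    recipDegreeSum G e ≤ 1 / 4 + 1 / (D - 4) := by
  induction e with
  | _ x y =>
    exact one_div_add_one_div_le (by exact_mod_cast hδ x) (by exact_mod_cast hδ y)
      (h x y (by simpa using he)) hD

/-- A lower bound for the number of edges in terms of the minimum degree `d`. -/
theorem exists_le_two_mul_card_edges [Nonempty V] (hδ : ∀ v, 4 ≤ G.degree v) {D : ℝ}
    (h : ∀ x y, G.Adj x y → D ≤ G.degree x + G.degree y) :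
    ∃ d e : ℝ, 4 ≤ d ∧ d ≤ e ∧ D - d ≤ e ∧ d * (2 * e + 1 - d) ≤ 2 * G.edgeFinset.card := by
  classical
  obtain ⟨u, hu⟩ := G.exists_minimal_degree_vertex
  have hmin : ∀ v, (G.degree u : ℝ) ≤ G.degree v := fun v => by
    exact_mod_cast hu ▸ G.minDegree_le_degree v
  have hd4 : (4 : ℝ) ≤ G.degree u := by exact_mod_cast hδ u
  set d := (G.degree u : ℝ) with hd
  set e : ℝ := max d (D - d) with he
  have hnb : ∀ v, G.Adj u v → e ≤ G.degree v := fun v hv =>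
    max_le (hmin v) (by have := h u v hv; linarith)
  refine ⟨d, e, hd4, le_max_left _ _, le_max_right _ _, ?_⟩
  obtain ⟨v, hv⟩ := (G.degree_pos_iff_exists_adj u).1 (by have := hδ u; omega)
  -- A neighbour of `u` already has degree at least `e`. Counting `e` for the `d` neighbours and `d`
  -- for all other vertices gives the bound.
  have hn : e + 1 ≤ Fintype.card V := by
    have h1 : (G.degree v : ℝ) + 1 ≤ Fintype.card V := by exact_mod_cast G.degree_lt_card_verts v
    linarith [hnb v hv]
  have hsum : ∑ v, (G.degree v : ℝ) = 2 * G.edgeFinset.card := by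
    exact_mod_cast G.sum_degrees_eq_twice_card_edges
  have hcard : ((G.neighborFinset u).card : ℝ) = d := by rw [card_neighborFinset_eq_degree]
  have hcard' : ((G.neighborFinset u)ᶜ.card : ℝ) = Fintype.card V - d := by
    rw [Finset.card_compl, Nat.cast_sub (Finset.card_le_univ _), hcard]
  have h1 : (G.neighborFinset u).card • e ≤ ∑ v ∈ G.neighborFinset u, (G.degree v : ℝ) :=
    Finset.card_nsmul_le_sum _ _ _ fun v hv => hnb v (by simpa using hv)
  have h2 : (G.neighborFinset u)ᶜ.card • d ≤ ∑ v ∈ (G.neighborFinset u)ᶜ, (G.degree v : ℝ) :=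
    Finset.card_nsmul_le_sum _ _ _ fun v _ => hmin v
  rw [← hsum, ← Finset.sum_add_sum_compl (G.neighborFinset u)]
  rw [nsmul_eq_mul, hcard] at h1
  rw [nsmul_eq_mul, hcard'] at h2
  nlinarith

namespace RegionSystem

variable {χ : ℤ}

/-- The discharging inequality for graphs without light edges. -/
theorem eulerChar_mul_le [Nonempty V] (S : RegionSystem G χ) (hδ : ∀ v, 4 ≤ G.degree v) {D : ℝ}
    (hD : 14 ≤ D) (h : ∀ x y, G.Adj x y → D ≤ G.degree x + G.degree y) :
    6 * (D - 4) * χ ≤ -(G.edgeFinset.card * (D - 12)) := by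
  have hG : ¬ G.IsAcyclic := not_isAcyclic_of_two_le_degree fun v => by have := hδ v; omega
  have hD4 : 0 < D - 4 := by linarith
  have hδ' : ∀ v, (4 : ℝ) ≤ G.degree v := fun v => by exact_mod_cast hδ v
  set t : ℝ := 1 / (D - 4) with ht
  have htD : t * (D - 4) = 1 := by rw [ht, one_div, inv_mul_cancel₀ hD4.ne']
  have ht0 : 0 < t := by positivity
  have ht10 : t ≤ 1 / 10 := one_div_le_one_div_of_le (by norm_num) (by linarith)
  -- Write |V| - |E| + #regions as a sum over edge sides: each carries half of its edge's reciprocal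
  -- sum, minus 1/2, and each region adds 1. The constant is the extremal triangle's charge 2t - 1/4
  -- shared among three sides; regions with at least four sides have slack.
  have hregion : ∀ ρ, ∑ e ∈ G.edgeFinset, (S.sides ρ e : ℝ) * (recipDegreeSum G e / 2 - 1 / 2) + 1 ≤
      -(1 / 12 - 2 / 3 * t) * ∑ e ∈ G.edgeFinset, (S.sides ρ e : ℝ) := by
    intro ρ
    rcases S.four_le_or_triangle hG ρ with h4 | ⟨x, y, z, hxy, hyz, hzx, h3, hw⟩
    · have h1 : ∑ e ∈ G.edgeFinset, (S.sides ρ e : ℝ) * (recipDegreeSum G e / 2 - 1 / 2) ≤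
          ∑ e ∈ G.edgeFinset, (S.sides ρ e : ℝ) * (t / 2 - 3 / 8) := by
        refine Finset.sum_le_sum fun e he => mul_le_mul_of_nonneg_left ?_ (Nat.cast_nonneg _)
        have := recipDegreeSum_le hδ (by linarith) h he
        linarith
      rw [← Finset.sum_mul] at h1
      have h2 : (4 : ℝ) ≤ ∑ e ∈ G.edgeFinset, (S.sides ρ e : ℝ) := by exact_mod_cast h4
      nlinarith
    · have h3' : ∑ e ∈ G.edgeFinset, (S.sides ρ e : ℝ) = 3 := by exact_mod_cast h3
      rw [hw, h3']
      have := sum_one_div_le (hδ' x) (hδ' y) (hδ' z) (h x y hxy) (h y z hyz) (h z x hzx)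
        (by linarith)
      have h2t : 2 / (D - 4) = 2 * t := by rw [ht]; ring
      simp only [recipDegreeSum, Sym2.lift_mk]
      linarith
  have htotal := Finset.sum_le_sum fun ρ (_ : ρ ∈ Finset.univ) => hregion ρ
  have hsides : ∀ w : Sym2 V → ℝ, ∑ ρ, ∑ e ∈ G.edgeFinset, (S.sides ρ e : ℝ) * w e =
      2 * ∑ e ∈ G.edgeFinset, w e := by
    intro w
    rw [Finset.sum_comm, Finset.mul_sum]
    refine Finset.sum_congr rfl fun e _ => ?_
    rw [← Finset.sum_mul, ← Nat.cast_sum, S.sum_sides, Nat.cast_ofNat]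
  have hone := hsides fun _ => 1
  simp only [mul_one, Finset.sum_const, nsmul_eq_mul] at hone
  rw [Finset.sum_add_distrib, hsides, ← Finset.mul_sum, hone, Finset.sum_sub_distrib,
    ← Finset.sum_div, sum_recipDegreeSum fun v => by have := hδ v; omega] at htotal
  simp only [Finset.sum_const, nsmul_eq_mul, Finset.card_univ, mul_one] at htotal
  have heuler : (χ : ℝ) + G.edgeFinset.card ≤ Fintype.card V + Fintype.card S.Region := by
    exact_mod_cast S.euler_le
  have hχ : (χ : ℝ) ≤ -(1 / 6 - 4 / 3 * t) * G.edgeFinset.card := by linarith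
  have := mul_le_mul_of_nonneg_left hχ (by linarith : 0 ≤ 6 * (D - 4))
  calc 6 * (D - 4) * χ ≤ _ := this
    _ = -(G.edgeFinset.card * ((D - 4) - 8 * (t * (D - 4)))) := by ring
    _ = _ := by rw [htD]; ring

theorem eulerChar_mul_le_of_cliqueFree [Nonempty V] (S : RegionSystem G χ)
    (hδ : ∀ v, 4 ≤ G.degree v) (hfree : G.CliqueFree 3) {D : ℝ}
    (hD : 8 < D) (h : ∀ x y, G.Adj x y → D ≤ G.degree x + G.degree y) :
    4 * (D - 4) * χ ≤ -(G.edgeFinset.card * (D - 8)) := by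
  have hG : ¬ G.IsAcyclic := not_isAcyclic_of_two_le_degree fun v => by have := hδ v; omega
  have hD4 : 0 < D - 4 := by linarith
  have h1 : (4 : ℝ) * Fintype.card S.Region ≤ 2 * G.edgeFinset.card := by
    exact_mod_cast (Nat.mul_le_mul_right _ (four_le_girth hG hfree)).trans
      (S.girth_mul_card_le hG)
  have heuler : (χ : ℝ) + G.edgeFinset.card ≤ Fintype.card V + Fintype.card S.Region := by
    exact_mod_cast S.euler_le
  have hpos : ∀ v, 1 ≤ G.degree v := fun v => by have := hδ v; omega
  have h2 : (Fintype.card V : ℝ) ≤ G.edgeFinset.card * (1 / 4 + 1 / (D - 4)) := by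
    rw [← sum_recipDegreeSum hpos, ← nsmul_eq_mul]
    exact Finset.sum_le_card_nsmul _ _ _ fun e he => recipDegreeSum_le hδ hD h he
  have hχ : (χ : ℝ) ≤ G.edgeFinset.card * (1 / 4 + 1 / (D - 4)) - G.edgeFinset.card / 2 := by
    linarith
  have := mul_le_mul_of_nonneg_left hχ (by linarith : 0 ≤ 4 * (D - 4))
  calc 4 * (D - 4) * χ ≤ _ := this
    _ = _ := by field_simp; ring

/-- Without a light edge, χ ≥ 0 contradicts `eulerChar_mul_le` at once. Otherwise 2χ > 12 - D turns
it into 2|E| < 6D - 24, against `six_mul_sub_le`. Equality 2χ = 12 - D gives only ≤, and D ≥ 17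
makes the lower bound strict. -/
theorem exists_light_edge [Nonempty V] (S : RegionSystem G χ) (hδ : ∀ v, 4 ≤ G.degree v) {D : ℕ}
    (hD : (14 ≤ D ∧ 0 ≤ χ) ∨ (16 ≤ D ∧ 12 < 2 * χ + D) ∨ (17 ≤ D ∧ 12 ≤ 2 * χ + D)) :
    ∃ x y, G.Adj x y ∧ G.degree x + G.degree y < D := by
  by_contra! hcon
  have h : ∀ x y, G.Adj x y → (D : ℝ) ≤ G.degree x + G.degree y := fun x y hxy => by
    exact_mod_cast hcon x y hxy
  have h14 : (14 : ℝ) ≤ D := by exact_mod_cast (show 14 ≤ D by omega)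
  have hχ := S.eulerChar_mul_le hδ h14 h
  obtain ⟨d, e, hd, hde, he, hm⟩ := exists_le_two_mul_card_edges hδ h
  have hm0 : (8 : ℝ) ≤ 2 * G.edgeFinset.card := by
    have := four_mul_sub_le hd hde he; linarith
  rcases hD with ⟨-, hD⟩ | hD
  · have : (0 : ℝ) ≤ χ := by exact_mod_cast hD
    nlinarith
  have h16 : (16 : ℝ) ≤ D := by exact_mod_cast (show 16 ≤ D by omega)
  have hsix := six_mul_sub_le hd hde he h16
  rcases hD with ⟨-, hD⟩ | ⟨h17, hD⟩
  · have hD' : (12 : ℝ) < 2 * χ + D := by exact_mod_cast hD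
    have hm' : 6 * (D : ℝ) - 24 ≤ 2 * G.edgeFinset.card := by
      rcases hsix with h' | h' <;> nlinarith
    nlinarith
  · have hD' : (12 : ℝ) ≤ 2 * χ + D := by exact_mod_cast hD
    have h17' : (17 : ℝ) ≤ D := by exact_mod_cast h17
    have hm' : 6 * (D : ℝ) - 24 < 2 * G.edgeFinset.card := by
      rcases hsix with h' | h' <;> nlinarith
    nlinarith

/-- For 2χ ≥ 10 - D the upper bound reads |E|(D - 8) ≤ 2(D - 4)(D - 10), while |E| ≥ 2(D - 6) and (D
- 6)(D - 8) exceeds (D - 4)(D - 10) by 8. -/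
theorem exists_light_edge_of_cliqueFree [Nonempty V] (S : RegionSystem G χ)
    (hδ : ∀ v, 4 ≤ G.degree v) (hfree : G.CliqueFree 3) {D : ℕ}
    (hD : (9 ≤ D ∧ 1 ≤ χ) ∨ (10 ≤ D ∧ 10 ≤ 2 * χ + D)) :
    ∃ x y, G.Adj x y ∧ G.degree x + G.degree y < D := by
  by_contra! hcon
  have h : ∀ x y, G.Adj x y → (D : ℝ) ≤ G.degree x + G.degree y := fun x y hxy => by
    exact_mod_cast hcon x y hxy
  have h9 : (9 : ℝ) ≤ D := by exact_mod_cast (show 9 ≤ D by omega)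
  have hχ := S.eulerChar_mul_le_of_cliqueFree hδ hfree (by linarith) h
  obtain ⟨d, e, hd, hde, he, hm⟩ := exists_le_two_mul_card_edges hδ h
  have hm' := (four_mul_sub_le hd hde he).trans hm
  rcases hD with ⟨-, hD⟩ | ⟨-, hD⟩
  · have : (1 : ℝ) ≤ χ := by exact_mod_cast hD
    nlinarith
  · have : (10 : ℝ) ≤ 2 * χ + D := by exact_mod_cast hD
    nlinarith

end RegionSystem

end LightEdges

/-! ### Assembling the bounds. -/

theorem EmbedsOn.exists_regionSystem {V : Type*} [Fintype V] [Nonempty V] {G : SimpleGraph V} {T : ClosedSurface} (h : EmbedsOn G T) :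
    Nonempty (RegionSystem G T.eulerChar) := by
  obtain ⟨F, hF, M, hM, hcarry⟩ := h
  exact hM.2 ▸ hcarry.exists_regionSystem

variable {V : Type*} [Fintype V] {G : SimpleGraph V} [DecidableRel G.Adj]

theorem exists_natCast_eq_totalRestrainedBondageNumber {V : Type*} {G : SimpleGraph V}
    {E : Finset (Sym2 V)}
    (h : IsTotalRestrainedBondageSet G E) :
    ∃ b : ℕ, totalRestrainedBondageNumber G = b :=
  ENat.ne_top_iff_exists.1 (ne_top_of_le_ne_top (ENat.natCast_ne_top _)
    (totalRestrainedBondageNumber_le h)) |>.imp fun _ => Eq.symm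

theorem bondage_add_four_le (hδ : 4 ≤ G.minDegree) {b : ℕ}
    (hb : totalRestrainedBondageNumber G = b) {x y : V} (hne : x ≠ y)
    (h : G.Adj x y ∨ ∃ w, G.Adj x w ∧ G.Adj y w) :
    b + 4 ≤ G.degree x + G.degree y + G.maxDegree := by
  have : ∃ E, IsTotalRestrainedBondageSet G E ∧
      E.card + 4 ≤ G.degree x + G.degree y + G.maxDegree := by
    rcases h with h | ⟨w, hxw, hyw⟩
    · exact bondage_adj hδ h
    · exact bondage_common_neighbor hδ hne hxw hyw
  obtain ⟨E, hE, hcard⟩ := this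
  have h1 := totalRestrainedBondageNumber_le hE
  rw [hb] at h1
  have : b ≤ E.card := by exact_mod_cast h1
  omega

theorem bondage_le_of_light_edge (hδ : 4 ≤ G.minDegree) {b : ℕ}
    (hb : totalRestrainedBondageNumber G = b) {D : ℕ}
    (h : ∃ x y, G.Adj x y ∧ G.degree x + G.degree y < D + 1) :
    (b : ℝ) ≤ D + G.maxDegree - 4 := by
  obtain ⟨x, y, hxy, hlt⟩ := h
  have := bondage_add_four_le hδ hb hxy.ne (Or.inl hxy)
  have : (b : ℝ) + 4 ≤ D + G.maxDegree := by exact_mod_cast (by omega : b + 4 ≤ D + G.maxDegree)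
  linarith

theorem ClosedSurface.eulerChar_le_two (T : ClosedSurface) : T.eulerChar ≤ 2 := by
  cases T <;> simp [ClosedSurface.eulerChar]

theorem girth_ratio_le {g n χ m : ℝ} (hg : 3 ≤ g) (hn : 0 < n) (hχ : χ ≤ n)
    (hm : (g - 2) * m ≤ g * (n - χ)) :
    2 * (2 * m / n) ≤ 4 * g / (g - 2) * (1 - χ / n) ∧
      4 * g / (g - 2) * (1 - χ / n) ≤ -12 * χ / n + 12 := by
  have hg2 : 0 < g - 2 := by linarith
  have h1 : 4 * g / (g - 2) * (1 - χ / n) = 4 * (g * (n - χ) / (g - 2)) / n := by field_simp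
  constructor
  · have h2 : m ≤ g * (n - χ) / (g - 2) := by rw [le_div_iff₀ hg2]; linarith
    rw [h1, show 2 * (2 * m / n) = 4 * m / n by ring]
    gcongr
  · have h2 : g * (n - χ) / (g - 2) ≤ 3 * (n - χ) := by
      rw [div_le_iff₀ hg2]
      nlinarith
    have h3 : -12 * χ / n + 12 = 4 * (3 * (n - χ)) / n := by field_simp; ring
    rw [h1, h3]
    gcongr

end SurfaceBondage

open SimpleGraph SurfaceBondage in
theorem theorem4p2 {V : Type*} [Fintype V] (G : SimpleGraph V) [DecidableRel G.Adj]
    (hconn : G.Connected) (hδ : 4 ≤ G.minDegree) :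
    ∃ b : ℕ, SurfaceBondage.totalRestrainedBondageNumber G = (b : ℕ∞) ∧
      (b : ℝ) ≤ (SurfaceBondage.minEdgeDegree G : ℝ) + (G.maxDegree : ℝ) - 2 ∧
      (∀ g : ℕ, SurfaceBondage.IsOrientableGenus G g →
        (b : ℝ) ≤ (SurfaceBondage.h₁ g : ℝ) + (G.maxDegree : ℝ) - 4 ∧
        (G.CliqueFree 3 → (b : ℝ) ≤ (SurfaceBondage.h₂ g : ℝ) + (G.maxDegree : ℝ) - 4)) ∧
      (∀ q : ℕ, SurfaceBondage.IsNonorientableGenus G q →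
        (b : ℝ) ≤ (SurfaceBondage.k₁ q : ℝ) + (G.maxDegree : ℝ) - 4 ∧
        (G.CliqueFree 3 → (b : ℝ) ≤ (SurfaceBondage.k₂ q : ℝ) + (G.maxDegree : ℝ) - 4)) ∧
      (b : ℝ) ≤ 2 * SurfaceBondage.averageDegree G + (G.maxDegree : ℝ) - 4 ∧
      (∀ χ : ℤ, SurfaceBondage.IsMaxEulerChar G χ →
        (b : ℝ) ≤ 4 * (G.girth : ℝ) / ((G.girth : ℝ) - 2) *
            (1 - (χ : ℝ) / (Fintype.card V : ℝ)) + (G.maxDegree : ℝ) - 4 ∧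
        4 * (G.girth : ℝ) / ((G.girth : ℝ) - 2) *
            (1 - (χ : ℝ) / (Fintype.card V : ℝ)) + (G.maxDegree : ℝ) - 4 ≤
          -12 * (χ : ℝ) / (Fintype.card V : ℝ) + (G.maxDegree : ℝ) + 8) := by
  have := hconn.nonempty
  have hd : ∀ v, 4 ≤ G.degree v := fun v => hδ.trans (G.minDegree_le_degree v)
  have hpos : ∀ v, 1 ≤ G.degree v := fun v => by have := hd v; omega
  have hG : ¬ G.IsAcyclic := not_isAcyclic_of_two_le_degree fun v => by have := hd v; omega
  obtain ⟨u⟩ := hconn.nonempty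
  obtain ⟨v, huv⟩ := (G.degree_pos_iff_exists_adj u).1 (hpos u)
  obtain ⟨E, hE, -⟩ := bondage_adj hδ huv
  obtain ⟨b, hb⟩ := exists_natCast_eq_totalRestrainedBondageNumber hE
  have hiv : (b : ℝ) ≤ 2 * averageDegree G + (G.maxDegree : ℝ) - 4 := by
    obtain ⟨x, y, hne, hadj, hle⟩ := exists_degree_add_le_two_mul_averageDegree hpos
    have : (b : ℝ) + 4 ≤ G.degree x + G.degree y + G.maxDegree := by
      exact_mod_cast bondage_add_four_le hδ hb hne hadj
    linarith
  refine ⟨b, hb, ?_, fun g hg => ?_, fun q hq => ?_, hiv, fun χ hχ => ?_⟩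
  · obtain ⟨x, y, hxy, hk⟩ : minEdgeDegree G ∈
        {k | ∃ x y, G.Adj x y ∧ k = G.degree x + G.degree y - 2} :=
      Nat.sInf_mem ⟨_, u, v, huv, rfl⟩
    have h1 := bondage_add_four_le hδ hb hxy.ne (Or.inl hxy)
    have h2 : (b : ℝ) + 2 ≤ minEdgeDegree G + G.maxDegree := by
      have := hd x
      exact_mod_cast (by omega : b + 2 ≤ minEdgeDegree G + G.maxDegree)
    linarith
  · obtain ⟨S⟩ := EmbedsOn.exists_regionSystem hg.1
    simp only [ClosedSurface.eulerChar] at S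
    refine ⟨bondage_le_of_light_edge hδ hb (S.exists_light_edge hd ?_), fun hfree =>
      bondage_le_of_light_edge hδ hb (S.exists_light_edge_of_cliqueFree hd hfree ?_)⟩
    -- Here D = h₁(g) + 1 and χ = 2 - 2g: genus 0 uses χ ≥ 0, and from genus 3 on 2χ + D = 12
    -- exactly.
    · unfold h₁; split_ifs <;> omega
    · unfold h₂; split_ifs <;> omega
  · obtain ⟨hq1, hemb⟩ := hq.1
    obtain ⟨S⟩ := hemb.exists_regionSystem
    simp only [ClosedSurface.eulerChar] at S
    refine ⟨bondage_le_of_light_edge hδ hb (S.exists_light_edge hd ?_), fun hfree =>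
      bondage_le_of_light_edge hδ hb (S.exists_light_edge_of_cliqueFree hd hfree ?_)⟩
    -- With χ = 2 - q, 2χ + D is 14 for 3 ≤ q ≤ 5 and exactly 12 from q = 6 on; for q ≤ 2, χ ≥ 0
    -- suffices.
    · unfold k₁; split_ifs <;> omega
    · unfold k₂; split_ifs <;> omega
  · obtain ⟨T, hemb, rfl⟩ := hχ.1
    obtain ⟨S⟩ := hemb.exists_regionSystem
    have hχ2 : (T.eulerChar : ℝ) ≤ 2 := by exact_mod_cast T.eulerChar_le_two
    have hn : (5 : ℝ) ≤ Fintype.card V := by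
      have h1 := G.degree_lt_card_verts u
      have h2 := hd u
      exact_mod_cast (by omega : 5 ≤ Fintype.card V)
    obtain ⟨h1, h2⟩ := girth_ratio_le (g := G.girth) (n := Fintype.card V) (χ := T.eulerChar)
      (m := G.edgeFinset.card) (by exact_mod_cast three_le_girth hG) (by linarith)
      (by linarith) (S.girth_sub_two_mul_card_edges_le hG)
    rw [averageDegree] at hiv
    constructor <;> linarith
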